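/- **Setting.** Let $\mathcal K\subset\mathbb R^d$ be nonempty, convex and compact with $\|x\|\le D$ for all $x\in\mathcal K$ (Euclidean norm), and let $\mathcal O$ be a linear optimization oracle, i.e. a measurable map with $\mathcal O(y)\in\arg\max_{x\in\mathcal K}\langle y,x\rangle$ for every $y\in\mathbb R^d$. In each of the rounds $t=1,\dots,T$ ($T\ge1$) the player plays $x_t\in\mathcal K$, and an adversary chooses a loss $f_t:\mathcal K\to\mathbb R$ that is convex and differentiable with $\|\nabla f_t(x)\|\le G$ on $\mathcal K$. The regret is $\sum_{t=1}^T f_t(x_t)-\min_{x\in\mathcal K}\sum_{t=1}^T f_t(x)$. A loss is $\beta$-smooth ($\beta\ge 0$) if its gradient is $\beta$-Lipschitz on $\mathcal K$. Let $\mathbb B$ be the closed unit ball of $\mathbb R^d$; "uniform" means uniformly distributed on $\mathbb B$. *Sampled FPL* ($\mathcal A_1$), with parameters $\delta>0$ and $m\ge1$: in round $t$ draw fresh i.i.d. uniform $v_t^1,\dots,v_t^m$, play $\tilde x_t=\frac1m\sum_{j=1}^m\mathcal O\big(-\sum_{s<t}\tilde\nabla_s+\frac1\delta v_t^j\big)$,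 then observe $\tilde\nabla_t=\nabla f_t(\tilde x_t)$. The adversary is adaptive: $f_t$ may depend measurably on everything that happened before round $t$ (including the player's earlier samples), while the samples of round $t$ are independent of that past. *Expected FPL* ($\mathcal A_3$), with parameter $\delta$: in round $t$ play $x_t=\mathbb E_{v}\big[\mathcal O(-\sum_{s<t}\nabla_s+\frac1\delta v)\big]$ with $v$ uniform, then observe $\nabla_t=\nabla f_t(x_t)$. Let $\mathcal R_T(\mathcal A_3)$ be its worst-case regret: the supremum of its regret over all sequences $f_1,\dots,f_T$ of convex differentiable losses on $\mathcal K$ with gradients bounded by $G$. *OSPF*, with parameter $\delta$, block size $k$ and an arbitrary $x_0\in\mathcal K$: in round $t$, if $k\nmid t$, play $x_t=x_{t-1}$; if $k\mid t$, draw fresh i.i.d. uniform $v_{t-k+1},\dots,v_t$ and play $x_t=\frac1k\sum_{j=1}^k\mathcal O\big(-\sum_{s=1}^{t-1}\nabla_s+\frac1\delta v_{t-k+j}\big)$; then observe $\nabla_t=\nabla f_t(x_t)$. **Theorem.** (1) $\mathcal R_T(\mathcal A_3)$ is finite and $\mathcal R_T(\mathcal A_3)\le \frac{2D}{\delta}+\frac{\delta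 D G^2 d\,T}{2}$. For every $\sigma>0$, with probability at least $1-\sigma$ the regret of $\mathcal A_1$ is at most $$\mathcal R_T(\mathcal A_3)+\frac{2GDT}{\sqrt m}\sqrt{\log\frac{2T}{\sigma}} .$$ If moreover all losses are $\beta$-smooth, then for every $\sigma>0$, with probability at least $1-\sigma$ the regret of $\mathcal A_1$ is at most $$\mathcal R_T(\mathcal A_3)+2GD\sqrt{2T\log\frac4\sigma}+\frac{8\beta D^2T}{m}\log\frac{4T}{\sigma}.$$ (2) There is an absolute constant $C>0$ such that the following holds for all $d,\mathcal K,\mathcal O,D,T$, all $G>0$ and $\beta\ge0$. Run OSPF with $k=\lceil T^{1/3}\rceil$ and $\delta=2/(G\sqrt d\,T^{2/3})$ against $\beta$-smooth losses that are chosen adaptively from block to block: for each $i\ge0$ the losses of the rounds $ik,\dots,ik+k-1$ may depend measurably on everything that happened before the samples of round $ik$ are drawn, and these samples are independent of that past. Then for every $\sigma>0$, with probability at least $1-\sigma$ the regret of OSPF is at most $$C\,D\,(G\sqrt d+\beta D)\,T^{2/3}\log\frac{4T}{\sigma}.$$ In particular it is $\tilde O(T^{2/3}\log\frac1\sigma)$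 with high probability. -/

import Mathlib

open MeasureTheory ProbabilityTheory

/-- The uniform distribution on the closed Euclidean unit ball of `ℝ^d`. -/
noncomputable def uniformBall (d : ℕ) : Measure (EuclideanSpace ℝ (Fin d)) :=
  ProbabilityTheory.cond volume (Metric.closedBall 0 1)

/-- `O` is a (measurable) linear optimization oracle over `K`: `O y` maximizes `⟪y, x⟫` over
`x ∈ K`, with an arbitrary measurable rule for breaking ties. -/
structure IsLinearOracle {d : ℕ} (K : Set (EuclideanSpace ℝ (Fin d)))
    (O : EuclideanSpace ℝ (Fin d) → EuclideanSpace ℝ (Fin d)) : Prop where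
  measurable : Measurable O
  mem : ∀ y, O y ∈ K
  isMax : ∀ y, ∀ x ∈ K, inner ℝ y x ≤ inner ℝ y (O y)

/-- The action set: a nonempty convex compact set of points of norm at most `D`. -/
structure IsActionSet {d : ℕ} (K : Set (EuclideanSpace ℝ (Fin d))) (D : ℝ) : Prop where
  nonempty : K.Nonempty
  convex : Convex ℝ K
  isCompact : IsCompact K
  norm_le : ∀ x ∈ K, ‖x‖ ≤ D

/-- `f` is a convex differentiable loss on `K` with gradient `f'` bounded in norm by `G` on `K`.
Only the restriction of `f` to `K` matters, so the gradient is taken within `K`. (If `K` has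
nonempty interior, it is unique; otherwise `f'` is any valid choice of it.) -/
structure IsLoss {d : ℕ} (K : Set (EuclideanSpace ℝ (Fin d))) (G : ℝ)
    (f : EuclideanSpace ℝ (Fin d) → ℝ)
    (f' : EuclideanSpace ℝ (Fin d) → EuclideanSpace ℝ (Fin d)) : Prop where
  convexOn : ConvexOn ℝ K f
  hasGradient : ∀ x ∈ K, HasGradientWithinAt f (f' x) K x
  norm_le : ∀ x ∈ K, ‖f' x‖ ≤ G

/-- A differentiable loss with gradient `f'` is `β`-smooth on `K`: its gradient is
`β`-Lipschitz on `K`. -/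
def IsSmoothOn {d : ℕ} (K : Set (EuclideanSpace ℝ (Fin d))) (β : ℝ)
    (f' : EuclideanSpace ℝ (Fin d) → EuclideanSpace ℝ (Fin d)) : Prop :=
  ∀ x ∈ K, ∀ y ∈ K, ‖f' x - f' y‖ ≤ β * ‖x - y‖

/-- The regret after rounds `1, …, T` of the actions `x 1, …, x T` against the losses
`f 1, …, f T`. -/
noncomputable def regret {d : ℕ} (K : Set (EuclideanSpace ℝ (Fin d))) (T : ℕ)
    (f : ℕ → EuclideanSpace ℝ (Fin d) → ℝ) (x : ℕ → EuclideanSpace ℝ (Fin d)) : ℝ :=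
  ∑ t ∈ Finset.Icc 1 T, f t (x t) - ⨅ u : K, ∑ t ∈ Finset.Icc 1 T, f t u

/-- The pair (action of round `t`, sum of the gradients observed in rounds `1, …, t`) of a player
who in round `t` plays `rule t x y`, where `x` is the previous action and `y` is the sum of the
gradients observed so far, and then observes the gradient of the loss at the action. -/
def gameState {d : ℕ}
    (rule : ℕ → EuclideanSpace ℝ (Fin d) → EuclideanSpace ℝ (Fin d) → EuclideanSpace ℝ (Fin d))
    (f' : ℕ → EuclideanSpace ℝ (Fin d) → EuclideanSpace ℝ (Fin d))
    (x₀ : EuclideanSpace ℝ (Fin d)) :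
    ℕ → EuclideanSpace ℝ (Fin d) × EuclideanSpace ℝ (Fin d)
  | 0 => (x₀, 0)
  | t + 1 =>
    let x := rule (t + 1) (gameState rule f' x₀ t).1 (gameState rule f' x₀ t).2
    (x, (gameState rule f' x₀ t).2 + f' (t + 1) x)

/-- The empirical perturbed leader `(1/m) ∑ j, O (-y + (1/δ) v j)`. -/
noncomputable def sampledLeader {d m : ℕ}
    (O : EuclideanSpace ℝ (Fin d) → EuclideanSpace ℝ (Fin d)) (δ : ℝ)
    (v : Fin m → EuclideanSpace ℝ (Fin d)) (y : EuclideanSpace ℝ (Fin d)) :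
    EuclideanSpace ℝ (Fin d) :=
  (1 / (m : ℝ)) • ∑ j, O (-y + (1 / δ) • v j)

/-- The expected perturbed leader `𝔼 O (-y + (1/δ) v)`, `v` uniform on the unit ball. -/
noncomputable def expectedLeader {d : ℕ}
    (O : EuclideanSpace ℝ (Fin d) → EuclideanSpace ℝ (Fin d)) (δ : ℝ)
    (y : EuclideanSpace ℝ (Fin d)) : EuclideanSpace ℝ (Fin d) :=
  ∫ v, O (-y + (1 / δ) • v) ∂(uniformBall d)

/-- The actions of Sampled Follow-the-Perturbed-Leader with samples `v t 1, …, v t m` in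
round `t ≥ 1`. -/
noncomputable def sampledFPL {d m : ℕ}
    (O : EuclideanSpace ℝ (Fin d) → EuclideanSpace ℝ (Fin d)) (δ : ℝ)
    (v : ℕ → Fin m → EuclideanSpace ℝ (Fin d))
    (f' : ℕ → EuclideanSpace ℝ (Fin d) → EuclideanSpace ℝ (Fin d)) (t : ℕ) :
    EuclideanSpace ℝ (Fin d) :=
  (gameState (fun t _ y => sampledLeader O δ (v t) y) f' 0 t).1

/-- The actions of Expected Follow-the-Perturbed-Leader in rounds `t ≥ 1`. -/
noncomputable def expectedFPL {d : ℕ}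
    (O : EuclideanSpace ℝ (Fin d) → EuclideanSpace ℝ (Fin d)) (δ : ℝ)
    (f' : ℕ → EuclideanSpace ℝ (Fin d) → EuclideanSpace ℝ (Fin d)) (t : ℕ) :
    EuclideanSpace ℝ (Fin d) :=
  (gameState (fun _ _ y => expectedLeader O δ y) f' 0 t).1

/-- The actions of Online Smooth Projection Free (OSPF) with block size `k`, starting point `x₀`
and samples `v 1, v 2, …`: a round `t` that is not a multiple of `k` repeats the previous action,
and a round `t` that is a multiple of `k` plays the empirical perturbed leader with the `k`
samples `v (t - k + 1), …, v t`. -/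
noncomputable def ospf {d : ℕ}
    (O : EuclideanSpace ℝ (Fin d) → EuclideanSpace ℝ (Fin d)) (δ : ℝ) (k : ℕ)
    (x₀ : EuclideanSpace ℝ (Fin d)) (v : ℕ → EuclideanSpace ℝ (Fin d))
    (f' : ℕ → EuclideanSpace ℝ (Fin d) → EuclideanSpace ℝ (Fin d)) (t : ℕ) :
    EuclideanSpace ℝ (Fin d) :=
  (gameState (fun t x y =>
    if t % k ≠ 0 then x
    else sampledLeader O δ (fun j : Fin k => v (t - k + (j + 1))) y) f' x₀ t).1

/-- The set of all regrets that Expected Follow-the-Perturbed-Leader can suffer in `T` rounds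
against losses with gradients bounded by `G`. (The algorithm is deterministic, so an adaptive
adversary is no more than a sequence of losses.) -/
def expectedFPLRegrets {d : ℕ} (K : Set (EuclideanSpace ℝ (Fin d)))
    (O : EuclideanSpace ℝ (Fin d) → EuclideanSpace ℝ (Fin d)) (δ G : ℝ) (T : ℕ) : Set ℝ :=
  {r | ∃ (f : ℕ → EuclideanSpace ℝ (Fin d) → ℝ)
      (f' : ℕ → EuclideanSpace ℝ (Fin d) → EuclideanSpace ℝ (Fin d)),
      (∀ t ∈ Finset.Icc 1 T, IsLoss K G (f t) (f' t)) ∧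
      r = regret K T f (expectedFPL O δ f')}

/-- The (worst-case) regret of Expected Follow-the-Perturbed-Leader after `T` rounds. -/
noncomputable def expectedFPLRegret {d : ℕ} (K : Set (EuclideanSpace ℝ (Fin d)))
    (O : EuclideanSpace ℝ (Fin d) → EuclideanSpace ℝ (Fin d)) (δ G : ℝ) (T : ℕ) : ℝ :=
  sSup (expectedFPLRegrets K O δ G T)

/-- `v 1, …, v m` are i.i.d. uniform samples from the unit ball, drawn independently of the
information `past` and revealed in the information `future`. -/
structure IsFreshSample {Ω : Type*} (past future : MeasurableSpace Ω) {mΩ : MeasurableSpace Ω}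
    (μ : Measure Ω) {d m : ℕ} (v : Fin m → Ω → EuclideanSpace ℝ (Fin d)) : Prop where
  measurable : ∀ j, Measurable[future] (v j)
  law : μ.map (fun ω j => v j ω) = Measure.pi (fun _ => uniformBall d)
  indep : Indep (⨆ j, MeasurableSpace.comap (v j) inferInstance) past μ

/-- The random loss `f` and its gradient `f'` are chosen on the basis of the information `past`. -/
def IsChosenFrom {Ω : Type*} {d : ℕ} (past : MeasurableSpace Ω)
    (f : Ω → EuclideanSpace ℝ (Fin d) → ℝ)
    (f' : Ω → EuclideanSpace ℝ (Fin d) → EuclideanSpace ℝ (Fin d)) : Prop :=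
  Measurable[past.prod inferInstance]
    (fun p : Ω × EuclideanSpace ℝ (Fin d) => f p.1 p.2) ∧
  Measurable[past.prod inferInstance]
    (fun p : Ω × EuclideanSpace ℝ (Fin d) => f' p.1 p.2)

/-! ### Linear regret of the expected leader through a smooth potential. -/

section Deterministic

open Filter Topology

variable {d : ℕ}

/-! By convexity the regret against `u` is at most `∑ ⟪g t, x t - u⟫`, where `g t` is the gradient
observed in round `t`. Only the realised gradients matter, and they may be treated as linear losses.

Expected FPL. The potential `Φ y = 𝔼 max_{x ∈ K} ⟪-y + v/δ, x⟫` (`leaderPotential`) is convex with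
gradient `-expectedLeader O δ y`. Translating the unit ball by `h` moves only a fraction of order `d
‖h‖` of its mass, so the expected leader is `δ D d`-Lipschitz and `Φ` is smooth
(`leaderPotential_descent`). Telescoping `Φ` along the gradient sums costs `δ D d ‖g‖² / 2` per
round, and the noise costs `D/δ` at each end.

Sampled FPL. Write its action as the expected leader plus a deviation `z t`. Expected FPL facing the
realised gradients as linear losses plays exactly these expected leaders, so pathwise the regret
exceeds the worst case of Expected FPL by at most `∑ ⟪g t, z t⟫` (`regret_sampledFPL_le`). A
dimension-free Hoeffding inequality gives `‖z t‖ ≲ D √(log / m)` in all rounds at once, whence the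
first bound. Under smoothness, `g t` is within `β ‖z t‖` of the gradient `h t` at the expected
leader. Unlike `g t`, `h t` is fixed by the past, so `∑ ⟪h t, z t⟫` is a martingale, handled by
Azuma; the replacement costs `β ‖z t‖²`, of order `1/m`.

OSPF is the same algorithm with blocks as rounds: `m = k` samples, gradient bound `k G`, smoothness
`k β`, about `T/k` rounds. The factor `k` in the smoothness cancels the `1/k` of the averaging, and
`k ≈ T^(1/3)` brings every term to `T^(2/3)`. -/

theorem IsLoss.sub_le {K : Set (EuclideanSpace ℝ (Fin d))} {G : ℝ}
    {f : EuclideanSpace ℝ (Fin d) → ℝ} {f' : EuclideanSpace ℝ (Fin d) → EuclideanSpace ℝ (Fin d)}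
    (h : IsLoss K G f f') {x u : EuclideanSpace ℝ (Fin d)} (hx : x ∈ K) (hu : u ∈ K) :
    f x - f u ≤ inner ℝ (f' x) (x - u) := by
  -- The gradient exists only within `K`, so the first-order inequality is taken on the segment from
  -- `x` to `u`, with the one-sided derivative at `0`.
  have hconv : ConvexOn ℝ (Set.Icc (0 : ℝ) 1) (fun s => f (AffineMap.lineMap x u s)) := by
    refine (h.convexOn.comp_affineMap (AffineMap.lineMap x u)).subset ?_ (convex_Icc 0 1)
    intro s hs
    exact h.convexOn.1.segment_subset hx hu
      (by rw [segment_eq_image_lineMap]; exact Set.mem_image_of_mem _ hs)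
  have hline : HasDerivWithinAt (fun s : ℝ => AffineMap.lineMap x u s) (u - x)
      (Set.Icc (0 : ℝ) 1) 0 :=
    AffineMap.hasDerivWithinAt_lineMap
  have hmaps : Set.MapsTo (fun s : ℝ => AffineMap.lineMap x u s) (Set.Icc (0 : ℝ) 1) K := by
    intro s hs
    exact h.convexOn.1.segment_subset hx hu
      (by rw [segment_eq_image_lineMap]; exact Set.mem_image_of_mem _ hs)
  have hgrad : HasFDerivWithinAt f (InnerProductSpace.toDual ℝ _ (f' x)) K
      (AffineMap.lineMap x u (0 : ℝ)) := by
    simpa using (h.hasGradient x hx).hasFDerivWithinAt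
  have hderiv := hgrad.comp_hasDerivWithinAt (0 : ℝ) hline hmaps
  have := hconv.le_slope_of_hasDerivWithinAt (x := 0) (y := 1) (by simp) (by simp) one_pos hderiv
  simp only [InnerProductSpace.toDual_apply_apply, slope_def_field, AffineMap.lineMap_apply_one,
    AffineMap.lineMap_apply_zero, sub_zero, div_one] at this
  rw [inner_sub_right] at this ⊢
  linarith

theorem isProbabilityMeasure_uniformBall (d : ℕ) : IsProbabilityMeasure (uniformBall d) := by
  refine cond_isProbabilityMeasure_of_finite ?_ ?_
  · exact (Metric.measure_closedBall_pos volume _ one_pos).ne'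
  · exact measure_closedBall_lt_top.ne

attribute [local instance] isProbabilityMeasure_uniformBall

theorem ae_norm_le_one_uniformBall (d : ℕ) : ∀ᵐ v ∂(uniformBall d), ‖v‖ ≤ 1 := by
  filter_upwards [ae_cond_mem (μ := volume)
    (measurableSet_closedBall (x := (0 : EuclideanSpace ℝ (Fin d))) (ε := 1))] with v hv
  simpa using hv

theorem integral_uniformBall {F : Type*} [NormedAddCommGroup F] [NormedSpace ℝ F]
    (φ : EuclideanSpace ℝ (Fin d) → F) :
    ∫ v, φ v ∂(uniformBall d) =
      (volume.real (Metric.closedBall (0 : EuclideanSpace ℝ (Fin d)) 1))⁻¹ •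
        ∫ v in Metric.closedBall 0 1, φ v := by
  rw [uniformBall, ProbabilityTheory.cond, integral_smul_measure, ENNReal.toReal_inv]
  rfl

/-- The intersection contains the ball of radius `1 - r/2` about the midpoint, `r` being the
distance of the centres, and `(1 - r/2)^d ≥ 1 - d r/2` by Bernoulli. For `r > 2` the bound is weaker
than the whole volume. -/
theorem volume_real_closedBall_diff_le (c c' : EuclideanSpace ℝ (Fin d)) :
    volume.real (Metric.closedBall c 1 \ Metric.closedBall c' 1) ≤
      d * dist c c' / 2 * volume.real (Metric.closedBall (0 : EuclideanSpace ℝ (Fin d)) 1) := by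
  have hV : 0 ≤ volume.real (Metric.closedBall (0 : EuclideanSpace ℝ (Fin d)) 1) :=
    measureReal_nonneg
  have hcen : volume.real (Metric.closedBall c 1) =
      volume.real (Metric.closedBall (0 : EuclideanSpace ℝ (Fin d)) 1) :=
    Measure.addHaar_real_closedBall_center volume c 1
  rcases Nat.eq_zero_or_pos d with rfl | hd
  · have : c = c' := Subsingleton.elim _ _
    simp [this]
  rcases le_or_gt (dist c c') 2 with h2 | h2
  · have hsub : Metric.closedBall (midpoint ℝ c c') (1 - dist c c' / 2) ⊆
        Metric.closedBall c 1 ∩ Metric.closedBall c' 1 := by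
      refine Set.subset_inter ?_ ?_ <;> refine Metric.closedBall_subset_closedBall' ?_
      · rw [dist_midpoint_left]; norm_num; linarith
      · rw [dist_midpoint_right]; norm_num; linarith
    have hfin : volume (Metric.closedBall c 1 ∩ Metric.closedBall c' 1) ≠ ⊤ :=
      ((measure_mono Set.inter_subset_left).trans_lt measure_closedBall_lt_top).ne
    have h1 := measureReal_mono (μ := volume) hsub hfin
    rw [Measure.addHaar_real_closedBall' volume _ (by linarith), finrank_euclideanSpace_fin] at h1
    have h3 := measureReal_sdiff_add_inter (μ := volume) (s := Metric.closedBall c 1)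
      (measurableSet_closedBall (x := c') (ε := 1)) measure_closedBall_lt_top.ne
    have h4 := one_add_mul_le_pow (a := -(dist c c' / 2)) (by linarith) d
    have h5 := mul_le_mul_of_nonneg_right h4 hV
    rw [← sub_eq_add_neg] at h5
    nlinarith
  · calc _ ≤ volume.real (Metric.closedBall c 1) :=
          measureReal_mono Set.sdiff_subset measure_closedBall_lt_top.ne
      _ = 1 * volume.real (Metric.closedBall (0 : EuclideanSpace ℝ (Fin d)) 1) := by
          rw [hcen, one_mul]
      _ ≤ _ := by
          gcongr
          have : (1 : ℝ) ≤ d := by exact_mod_cast hd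
          nlinarith

/-- The integrals over the ball and its translate differ only on the two crescents, each carrying at
most a fraction `d ‖h‖ / 2` of the volume. -/
theorem norm_integral_uniformBall_add_sub_le {φ : EuclideanSpace ℝ (Fin d) →
    EuclideanSpace ℝ (Fin d)} (hφ : Measurable φ) {D : ℝ} (hD : ∀ v, ‖φ v‖ ≤ D)
    (h : EuclideanSpace ℝ (Fin d)) :
    ‖∫ v, φ (v + h) ∂(uniformBall d) - ∫ v, φ v ∂(uniformBall d)‖ ≤ d * D * ‖h‖ := by
  set B := Metric.closedBall (0 : EuclideanSpace ℝ (Fin d)) 1 with hB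
  set B' := Metric.closedBall h 1 with hB'
  have hpos : 0 < volume.real B := by
    rw [measureReal_def]
    exact ENNReal.toReal_pos (Metric.measure_closedBall_pos volume _ one_pos).ne'
      measure_closedBall_lt_top.ne
  have hD0 : 0 ≤ D := (norm_nonneg _).trans (hD 0)
  have hshift : ∫ v in B, φ (v + h) = ∫ v in B', φ v := by
    have := (measurePreserving_add_right volume h).setIntegral_preimage_emb
      (measurableEmbedding_addRight h) φ B'
    rw [← this]
    congr 2
    ext v
    simp [hB, hB', dist_eq_norm]
  have hint : ∀ c : EuclideanSpace ℝ (Fin d), IntegrableOn φ (Metric.closedBall c 1) := fun c =>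
    Measure.integrableOn_of_bounded measure_closedBall_lt_top.ne hφ.aestronglyMeasurable
      (ae_of_all _ hD)
  have e1 := integral_inter_add_sdiff (μ := volume) (f := φ) (s := B)
    (measurableSet_closedBall (x := h) (ε := 1)) (hint 0)
  have e2 := integral_inter_add_sdiff (μ := volume) (f := φ) (s := B')
    (measurableSet_closedBall (x := 0) (ε := 1)) (hint h)
  have b1 : ‖∫ v in B \ B', φ v‖ ≤ D * (d * ‖h‖ / 2 * volume.real B) := by
    refine (norm_setIntegral_le_of_norm_le_const
      ((measure_mono Set.sdiff_subset).trans_lt measure_closedBall_lt_top)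
      (fun v _ => hD v)).trans ?_
    gcongr
    simpa using volume_real_closedBall_diff_le (0 : EuclideanSpace ℝ (Fin d)) h
  have b2 : ‖∫ v in B' \ B, φ v‖ ≤ D * (d * ‖h‖ / 2 * volume.real B) := by
    refine (norm_setIntegral_le_of_norm_le_const
      ((measure_mono Set.sdiff_subset).trans_lt measure_closedBall_lt_top)
      (fun v _ => hD v)).trans ?_
    gcongr
    simpa using volume_real_closedBall_diff_le h (0 : EuclideanSpace ℝ (Fin d))
  have key : (∫ v in B', φ v) - (∫ v in B, φ v) =
      (∫ v in B' \ B, φ v) - (∫ v in B \ B', φ v) := by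
    rw [← e1, ← e2, Set.inter_comm B' B]
    abel
  rw [integral_uniformBall, integral_uniformBall, ← smul_sub, hshift, key, norm_smul, norm_inv,
    Real.norm_of_nonneg hpos.le]
  calc (volume.real B)⁻¹ * ‖(∫ v in B' \ B, φ v) - (∫ v in B \ B', φ v)‖
      ≤ (volume.real B)⁻¹ * (D * (d * ‖h‖ / 2 * volume.real B)
          + D * (d * ‖h‖ / 2 * volume.real B)) := by
        gcongr
        exact (norm_sub_le _ _).trans (add_le_add b2 b1)
    _ = d * D * ‖h‖ := by field_simp; ring

variable {K : Set (EuclideanSpace ℝ (Fin d))}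
  {O : EuclideanSpace ℝ (Fin d) → EuclideanSpace ℝ (Fin d)} {D δ : ℝ}

theorem IsActionSet.nonneg (hK : IsActionSet K D) : 0 ≤ D :=
  let ⟨x, hx⟩ := hK.nonempty
  (norm_nonneg x).trans (hK.norm_le x hx)

theorem IsActionSet.norm_sub_le (hK : IsActionSet K D) {x y : EuclideanSpace ℝ (Fin d)}
    (hx : x ∈ K) (hy : y ∈ K) : ‖x - y‖ ≤ 2 * D :=
  (_root_.norm_sub_le x y).trans (by linarith [hK.norm_le x hx, hK.norm_le y hy])

theorem IsLinearOracle.norm_le (hO : IsLinearOracle K O) (hK : IsActionSet K D)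
    (y : EuclideanSpace ℝ (Fin d)) : ‖O y‖ ≤ D :=
  hK.norm_le _ (hO.mem y)

theorem IsLinearOracle.measurable_perturbed (hO : IsLinearOracle K O) (δ : ℝ)
    (y : EuclideanSpace ℝ (Fin d)) : Measurable fun v => O (-y + (1 / δ) • v) :=
  hO.measurable.comp (by fun_prop)

theorem IsLinearOracle.integrable_perturbed (hO : IsLinearOracle K O) (hK : IsActionSet K D)
    (δ : ℝ) (y : EuclideanSpace ℝ (Fin d)) :
    Integrable (fun v => O (-y + (1 / δ) • v)) (uniformBall d) :=
  Integrable.of_bound (hO.measurable_perturbed δ y).aestronglyMeasurable D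
    (ae_of_all _ fun _ => hO.norm_le hK _)

theorem expectedLeader_mem (hK : IsActionSet K D) (hO : IsLinearOracle K O)
    (y : EuclideanSpace ℝ (Fin d)) : expectedLeader O δ y ∈ K :=
  hK.convex.integral_mem hK.isCompact.isClosed (ae_of_all _ fun _ => hO.mem _)
    (hO.integrable_perturbed hK δ y)

theorem sampledLeader_mem (hK : IsActionSet K D) (hO : IsLinearOracle K O) {m : ℕ} (hm : 1 ≤ m)
    (v : Fin m → EuclideanSpace ℝ (Fin d)) (y : EuclideanSpace ℝ (Fin d)) :
    sampledLeader O δ v y ∈ K := by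
  rw [sampledLeader, Finset.smul_sum]
  refine hK.convex.sum_mem (fun _ _ => by positivity) ?_ fun _ _ => hO.mem _
  have : (m : ℝ) ≠ 0 := by positivity
  simp [this]

/-- Changing the gradient sum from `y` to `y'` is the same as translating the noise by `δ (y - y')`.
-/
theorem norm_expectedLeader_sub_le (hK : IsActionSet K D) (hO : IsLinearOracle K O) (hδ : 0 < δ)
    (y y' : EuclideanSpace ℝ (Fin d)) :
    ‖expectedLeader O δ y' - expectedLeader O δ y‖ ≤ δ * D * d * ‖y' - y‖ := by
  have h := norm_integral_uniformBall_add_sub_le (hO.measurable_perturbed δ y)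
    (fun v => hO.norm_le hK _) (δ • (y - y'))
  have e : ∀ v, -y + (1 / δ) • (v + δ • (y - y')) = -y' + (1 / δ) • v := by
    intro v
    rw [smul_add, smul_smul, one_div_mul_cancel hδ.ne', one_smul]
    abel
  simp only [e] at h
  refine h.trans_eq ?_
  rw [norm_smul, Real.norm_of_nonneg hδ.le, norm_sub_rev y y']
  ring

/-- The expected value of the perturbed leader's linear program at the gradient sum `y`. -/
noncomputable def leaderPotential (O : EuclideanSpace ℝ (Fin d) → EuclideanSpace ℝ (Fin d))
    (δ : ℝ) (y : EuclideanSpace ℝ (Fin d)) : ℝ :=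
  ∫ v, inner ℝ (-y + (1 / δ) • v) (O (-y + (1 / δ) • v)) ∂(uniformBall d)

theorem integrable_inner_perturbed (hK : IsActionSet K D) (hO : IsLinearOracle K O)
    (δ : ℝ) (y z : EuclideanSpace ℝ (Fin d)) :
    Integrable (fun v => inner ℝ (-y + (1 / δ) • v) (O (-z + (1 / δ) • v))) (uniformBall d) := by
  refine Integrable.of_bound (Measurable.aestronglyMeasurable ?_) ((‖y‖ + |1 / δ|) * D) ?_
  · exact Measurable.inner (by fun_prop) (hO.measurable_perturbed δ z)
  · filter_upwards [ae_norm_le_one_uniformBall d] with v hv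
    refine (norm_inner_le_norm _ _).trans ?_
    gcongr
    · refine (norm_add_le _ _).trans ?_
      rw [norm_neg, norm_smul, Real.norm_eq_abs]
      gcongr
      exact mul_le_of_le_one_right (abs_nonneg _) hv
    · exact hO.norm_le hK _

/-- This is the subgradient inequality of the convex potential based at the endpoint `y + g`: the
maximizer at `y + g` is only a competitor at `y`. -/
theorem leaderPotential_add_le (hK : IsActionSet K D) (hO : IsLinearOracle K O)
    (y g : EuclideanSpace ℝ (Fin d)) :
    leaderPotential O δ (y + g) ≤
      leaderPotential O δ y - inner ℝ g (expectedLeader O δ (y + g)) := by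
  have hg : inner ℝ g (expectedLeader O δ (y + g)) =
      ∫ v, inner ℝ g (O (-(y + g) + (1 / δ) • v)) ∂(uniformBall d) :=
    (integral_inner (hO.integrable_perturbed hK δ (y + g)) g).symm
  have hgi : Integrable (fun v => inner ℝ g (O (-(y + g) + (1 / δ) • v))) (uniformBall d) :=
    (hO.integrable_perturbed hK δ (y + g)).const_inner g
  rw [le_sub_iff_add_le, hg, leaderPotential, leaderPotential,
    ← integral_add (integrable_inner_perturbed hK hO δ _ _) hgi]
  refine integral_mono ((integrable_inner_perturbed hK hO δ _ _).add hgi)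
    (integrable_inner_perturbed hK hO δ _ _) fun v => ?_
  simp only
  rw [← inner_add_left]
  have e : -(y + g) + (1 / δ) • v + g = -y + (1 / δ) • v := by abel
  rw [e]
  exact hO.isMax _ _ (hO.mem _)

theorem leaderPotential_zero_le (hK : IsActionSet K D) (hO : IsLinearOracle K O) (hδ : 0 < δ) :
    leaderPotential O δ 0 ≤ D / δ := by
  refine (integral_mono_ae (integrable_inner_perturbed hK hO δ _ _)
    (integrable_const (D / δ)) ?_).trans_eq (by simp)
  filter_upwards [ae_norm_le_one_uniformBall d] with v hv
  refine (real_inner_le_norm _ _).trans ?_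
  rw [neg_zero, zero_add, norm_smul, Real.norm_of_nonneg (by positivity)]
  calc 1 / δ * ‖v‖ * ‖O ((1 / δ) • v)‖ ≤ 1 / δ * 1 * D := by
        gcongr
        exact hO.norm_le hK _
    _ = D / δ := by ring

theorem le_leaderPotential (hK : IsActionSet K D) (hO : IsLinearOracle K O) (hδ : 0 < δ)
    (y : EuclideanSpace ℝ (Fin d)) {u : EuclideanSpace ℝ (Fin d)} (hu : u ∈ K) :
    - inner ℝ y u - D / δ ≤ leaderPotential O δ y := by
  refine Eq.trans_le (by simp) (integral_mono_ae (integrable_const (- inner ℝ y u - D / δ))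
    (integrable_inner_perturbed hK hO δ _ _) ?_)
  filter_upwards [ae_norm_le_one_uniformBall d] with v hv
  refine le_trans ?_ (hO.isMax _ u hu)
  rw [inner_add_left, inner_neg_left]
  have h1 := abs_le.1 (abs_real_inner_le_norm ((1 / δ) • v) u)
  have h2 : ‖(1 / δ) • v‖ * ‖u‖ ≤ D / δ := by
    rw [norm_smul, Real.norm_of_nonneg (by positivity)]
    calc 1 / δ * ‖v‖ * ‖u‖ ≤ 1 / δ * 1 * D := by
          gcongr
          exact hK.norm_le u hu
      _ = D / δ := by ring
  linarith [h1.1]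

/-- The potential is smooth along its gradient, the expected leader. -/
theorem leaderPotential_descent (hK : IsActionSet K D) (hO : IsLinearOracle K O) (hδ : 0 < δ)
    (y g : EuclideanSpace ℝ (Fin d)) :
    leaderPotential O δ (y + g) ≤
      leaderPotential O δ y - inner ℝ g (expectedLeader O δ y) + δ * D * d / 2 * ‖g‖ ^ 2 := by
  have hD := hK.nonneg
  -- The descent lemma without differentiating: the move is cut into `n` equal steps, each using the
  -- endpoint inequality, and the leader after `i` steps is compared with the one at `y`. The errors
  -- add up to `1 + ⋯ + n`, which for `s = 1/n` yields the factor `1/2` in the limit.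
  have step : ∀ n : ℕ, ∀ s : ℝ, 0 ≤ s →
      leaderPotential O δ (y + (n * s) • g) ≤
        leaderPotential O δ y - (n * s) * inner ℝ g (expectedLeader O δ y) +
          δ * D * d * ‖g‖ ^ 2 * (s ^ 2 * (n * (n + 1) / 2)) := by
    intro n s hs
    induction n with
    | zero => simp
    | succ n ih =>
      have h1 := leaderPotential_add_le (δ := δ) hK hO (y + (n * s) • g) (s • g)
      have e : y + (n * s) • g + s • g = y + (((n + 1 : ℕ) : ℝ) * s) • g := by
        rw [add_assoc, ← add_smul]; push_cast; ring_nf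
      rw [e] at h1
      have h2 := norm_expectedLeader_sub_le hK hO hδ y (y + (((n + 1 : ℕ) : ℝ) * s) • g)
      have h3 := abs_le.1 (abs_real_inner_le_norm g
        (expectedLeader O δ (y + (((n + 1 : ℕ) : ℝ) * s) • g) - expectedLeader O δ y))
      rw [add_sub_cancel_left, norm_smul, Real.norm_of_nonneg (by positivity)] at h2
      have h4 := mul_le_mul_of_nonneg_left h2 (norm_nonneg g)
      rw [inner_sub_right] at h3
      rw [real_inner_smul_left] at h1
      have h5 := mul_le_mul_of_nonneg_left (h3.1) hs
      have h6 := mul_le_mul_of_nonneg_left h4 hs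
      push_cast at *
      nlinarith
  have lim : Tendsto (fun n : ℕ => leaderPotential O δ y - inner ℝ g (expectedLeader O δ y) +
      δ * D * d * ‖g‖ ^ 2 * (1 / 2 + 1 / 2 * (1 / ((n : ℝ) + 1)))) atTop
      (𝓝 (leaderPotential O δ y - inner ℝ g (expectedLeader O δ y) +
      δ * D * d * ‖g‖ ^ 2 * (1 / 2 + 1 / 2 * 0))) :=
    ((tendsto_one_div_add_atTop_nhds_zero_nat.const_mul _).const_add _ |>.const_mul _).const_add _
  refine (ge_of_tendsto' lim fun n => ?_).trans_eq (by ring)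
  have h := step (n + 1) (1 / (n + 1)) (by positivity)
  have e : ((n + 1 : ℕ) : ℝ) * (1 / (n + 1)) = 1 := by push_cast; field_simp
  rw [e, one_smul, one_mul] at h
  refine h.trans_eq ?_
  push_cast
  field_simp

/-- The expected perturbed leader has small regret against every sequence of linear losses. -/
theorem sum_inner_expectedLeader_sub_le (hK : IsActionSet K D) (hO : IsLinearOracle K O)
    (hδ : 0 < δ) (g : ℕ → EuclideanSpace ℝ (Fin d)) (n : ℕ) {u : EuclideanSpace ℝ (Fin d)}
    (hu : u ∈ K) :
    ∑ i ∈ Finset.range n, inner ℝ (g i) (expectedLeader O δ (∑ j ∈ Finset.range i, g j) - u) ≤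
      2 * D / δ + δ * D * d / 2 * ∑ i ∈ Finset.range n, ‖g i‖ ^ 2 := by
  have h : ∀ n, ∑ i ∈ Finset.range n,
      inner ℝ (g i) (expectedLeader O δ (∑ j ∈ Finset.range i, g j)) ≤
      leaderPotential O δ 0 - leaderPotential O δ (∑ j ∈ Finset.range n, g j) +
        δ * D * d / 2 * ∑ i ∈ Finset.range n, ‖g i‖ ^ 2 := by
    intro n
    induction n with
    | zero => simp
    | succ n ih =>
      rw [Finset.sum_range_succ, Finset.sum_range_succ, Finset.sum_range_succ]
      linarith [leaderPotential_descent hK hO hδ (∑ j ∈ Finset.range n, g j) (g n)]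
  have h0 := leaderPotential_zero_le hK hO hδ
  have h1 := le_leaderPotential hK hO hδ (∑ j ∈ Finset.range n, g j) hu
  simp only [inner_sub_right, Finset.sum_sub_distrib]
  rw [← sum_inner]
  have := h n
  have e : 2 * D / δ = D / δ + D / δ := by ring
  linarith

end Deterministic

/-! ### Exponential moments and a dimension-free Hoeffding inequality. -/

section Concentration

open scoped ENNReal

theorem lintegral_exp_mul_le_of_abs_sub_le {α : Type*} [MeasurableSpace α] (ν : Measure α)
    [IsProbabilityMeasure ν] {W : α → ℝ} (hW : Measurable W) {c R : ℝ}
    (hc : ∀ a, |W a - c| ≤ R) (l : ℝ) :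
    ∫⁻ a, ENNReal.ofReal (Real.exp (l * W a)) ∂ν ≤
      ENNReal.ofReal (Real.exp (l * ∫ a, W a ∂ν + l ^ 2 * R ^ 2 / 2)) := by
  have hmem : ∀ᵐ a ∂ν, W a ∈ Set.Icc (c - R) (c + R) := ae_of_all _ fun a => by
    have := abs_le.1 (hc a)
    constructor <;> linarith
  have hsub := hasSubgaussianMGF_of_mem_Icc hW.aemeasurable hmem
  have hint : Integrable (fun a => Real.exp (l * W a)) ν :=
    integrable_exp_mul_of_mem_Icc hW.aemeasurable hmem
  rw [← ofReal_integral_eq_lintegral_ofReal hint (ae_of_all _ fun _ => (Real.exp_pos _).le)]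
  refine ENNReal.ofReal_le_ofReal ?_
  have h := hsub.mgf_le l
  have e1 : mgf (fun a => W a - ∫ a, W a ∂ν) ν l =
      Real.exp (-(l * ∫ a, W a ∂ν)) * ∫ a, Real.exp (l * W a) ∂ν := by
    rw [mgf, ← integral_const_mul]
    congr 1
    ext a
    rw [← Real.exp_add]
    ring_nf
  have e2 : (((‖(c + R) - (c - R)‖₊ / 2) ^ 2 : NNReal) : ℝ) = R ^ 2 := by
    push_cast
    rw [div_pow, Real.norm_eq_abs, sq_abs]
    ring
  rw [e1, e2, Real.exp_neg, inv_mul_le_iff₀ (Real.exp_pos _), ← Real.exp_add] at h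
  refine h.trans_eq ?_
  ring_nf

/-- The square root is the Hilbert-type norm of the pair `(x, √s)`, hence 1-Lipschitz in `x`. -/
theorem abs_sqrt_norm_sq_add_sub_le {E : Type*} [NormedAddCommGroup E] (x y : E) {s : ℝ}
    (hs : 0 ≤ s) : |√(‖x‖ ^ 2 + s) - √(‖y‖ ^ 2 + s)| ≤ ‖x - y‖ := by
  have key : ∀ x y : E, √(‖x‖ ^ 2 + s) - √(‖y‖ ^ 2 + s) ≤ ‖x - y‖ := by
    intro x y
    rw [sub_le_iff_le_add', Real.sqrt_le_iff]
    refine ⟨by positivity, ?_⟩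
    have h1 : ‖x‖ ≤ ‖y‖ + ‖x - y‖ := by
      simpa using norm_add_le y (x - y)
    have h2 : ‖y‖ ≤ √(‖y‖ ^ 2 + s) := Real.le_sqrt_of_sq_le (by linarith)
    have h3 := Real.sq_sqrt (show 0 ≤ ‖y‖ ^ 2 + s by positivity)
    have h4 := mul_le_mul_of_nonneg_right h2 (norm_nonneg (x - y))
    have h5 := pow_le_pow_left₀ (norm_nonneg x) h1 2
    nlinarith
  rw [abs_le]
  have := key y x
  rw [norm_sub_rev] at this
  exact ⟨by linarith, key x y⟩

variable {E : Type*} [NormedAddCommGroup E] [InnerProductSpace ℝ E] [CompleteSpace E]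
  [MeasurableSpace E] [BorelSpace E] [SecondCountableTopology E]
  {α : Type*} [MeasurableSpace α] (ν : Measure α) [IsProbabilityMeasure ν] {X : α → E} {D : ℝ}

theorem integral_norm_add_sub_integral_sq_le (hX : Measurable X) (hD : ∀ a, ‖X a‖ ≤ D) (b : E) :
    ∫ a, ‖b + (X a - ∫ a, X a ∂ν)‖ ^ 2 ∂ν ≤ ‖b‖ ^ 2 + D ^ 2 := by
  set c := ∫ a, X a ∂ν with hc
  have hXi : Integrable X ν := Integrable.of_bound hX.aestronglyMeasurable D (ae_of_all _ hD)
  have e : ∀ a, ‖b + (X a - c)‖ ^ 2 ≤ (‖b - c‖ ^ 2 + D ^ 2) + 2 * inner ℝ (b - c) (X a) := by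
    intro a
    have h1 : b + (X a - c) = (b - c) + X a := by abel
    rw [h1, norm_add_sq_real]
    have := pow_le_pow_left₀ (norm_nonneg _) (hD a) 2
    linarith
  have hi : Integrable (fun a => 2 * inner ℝ (b - c) (X a)) ν :=
    (hXi.const_inner _).const_mul 2
  have h := integral_mono_of_nonneg (μ := ν) (ae_of_all _ fun a => sq_nonneg ‖b + (X a - c)‖)
    ((integrable_const (‖b - c‖ ^ 2 + D ^ 2)).add hi) (ae_of_all _ e)
  refine h.trans ?_
  simp only [Pi.add_apply]
  rw [integral_add (integrable_const _) hi, integral_const_mul, integral_inner hXi, ← hc]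
  simp only [integral_const, probReal_univ, one_smul]
  rw [norm_sub_sq_real, inner_sub_left, real_inner_self_eq_norm_sq]
  nlinarith [sq_nonneg ‖c‖]

/-- One sample raises the mean of the smoothed norm no further than adding `D²` under the root, by
Jensen and the variance bound. Its fluctuation is controlled by Hoeffding's lemma. Adding `k D²`
under the root gives the bound the same form as the integrand, so that it can be iterated. -/
theorem lintegral_exp_sqrt_norm_add_sq_le (hX : Measurable X) (hD0 : 0 < D)
    (hD : ∀ a, ‖X a‖ ≤ D) (b : E) (k : ℕ) {l : ℝ} (hl : 0 ≤ l) :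
    ∫⁻ a, ENNReal.ofReal
        (Real.exp (l * √(‖b + (X a - ∫ a, X a ∂ν)‖ ^ 2 + k * D ^ 2))) ∂ν ≤
      ENNReal.ofReal (Real.exp (l * √(‖b‖ ^ 2 + (k + 1) * D ^ 2) + l ^ 2 * D ^ 2 / 2)) := by
  set c := ∫ a, X a ∂ν with hc
  have hm : Measurable fun a => √(‖b + (X a - c)‖ ^ 2 + k * D ^ 2) := by fun_prop
  -- Centring at the value for `X a = 0` gives half-width `D`, not `2 D`.
  refine (lintegral_exp_mul_le_of_abs_sub_le ν hm (c := √(‖b - c‖ ^ 2 + k * D ^ 2)) (R := D)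
    (fun a => ?_) l).trans ?_
  · refine (abs_sqrt_norm_sq_add_sub_le _ _ (by positivity)).trans ?_
    have e : b + (X a - c) - (b - c) = X a := by abel
    rw [e]
    exact hD a
  · gcongr
    set r := √(‖b‖ ^ 2 + (k + 1) * D ^ 2) with hr
    have hr0 : 0 < r := Real.sqrt_pos.2 (by positivity)
    have hr2 : r ^ 2 = ‖b‖ ^ 2 + (k + 1) * D ^ 2 := Real.sq_sqrt (by positivity)
    have hXi : Integrable X ν := Integrable.of_bound hX.aestronglyMeasurable D (ae_of_all _ hD)
    have hsq : Integrable (fun a => ‖b + (X a - c)‖ ^ 2) ν := by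
      refine Integrable.of_bound (by fun_prop) ((‖b‖ + (D + ‖c‖)) ^ 2) (ae_of_all _ fun a => ?_)
      rw [Real.norm_of_nonneg (by positivity)]
      gcongr
      refine (norm_add_le _ _).trans ?_
      gcongr
      refine (norm_sub_le _ _).trans ?_
      gcongr
      exact hD a
    -- The square root lies below its tangent at `r²`; this is Jensen's inequality made explicit.
    have hpt : ∀ a, √(‖b + (X a - c)‖ ^ 2 + k * D ^ 2) ≤
        1 / (2 * r) * ‖b + (X a - c)‖ ^ 2 + 1 / (2 * r) * (k * D ^ 2 + r ^ 2) := by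
      intro a
      have h1 := Real.sq_sqrt (show 0 ≤ ‖b + (X a - c)‖ ^ 2 + k * D ^ 2 by positivity)
      rw [← mul_add, ← add_assoc, div_mul_eq_mul_div, le_div_iff₀ (by positivity)]
      nlinarith [sq_nonneg (√(‖b + (X a - c)‖ ^ 2 + k * D ^ 2) - r)]
    have h := integral_mono_of_nonneg (μ := ν) (ae_of_all _ fun a => Real.sqrt_nonneg _)
      ((hsq.const_mul (1 / (2 * r))).add
        (integrable_const (1 / (2 * r) * (k * D ^ 2 + r ^ 2)))) (ae_of_all _ hpt)
    refine h.trans ?_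
    simp only [Pi.add_apply]
    rw [integral_add (hsq.const_mul _) (integrable_const _), integral_const_mul]
    simp only [integral_const, probReal_univ, one_smul]
    rw [← mul_add, div_mul_eq_mul_div, div_le_iff₀ (by positivity)]
    have := integral_norm_add_sub_integral_sq_le ν hX hD b
    rw [← hc] at this
    nlinarith

theorem lintegral_pi_fin_succ {n : ℕ} {F : (Fin (n + 1) → α) → ℝ≥0∞} (hF : Measurable F) :
    ∫⁻ v, F v ∂(Measure.pi fun _ => ν) =
      ∫⁻ a, ∫⁻ w, F (Fin.cons a w) ∂(Measure.pi fun _ => ν) ∂ν := by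
  have h := (measurePreserving_piFinSuccAbove (fun _ : Fin (n + 1) => ν) 0).symm
  have hp := lintegral_prod _ (hF.comp h.measurable).aemeasurable
    (μ := ν) (ν := Measure.pi fun _ : Fin n => ν)
  rw [← h.lintegral_comp hF]
  refine hp.trans ?_
  simp [MeasurableEquiv.piFinSuccAbove_symm_apply, Fin.insertNthEquiv]

theorem lintegral_pi_exp_sqrt_norm_add_sq_le (hX : Measurable X) (hD0 : 0 < D)
    (hD : ∀ a, ‖X a‖ ≤ D) {l : ℝ} (hl : 0 ≤ l) (m k : ℕ) (b : E) :
    ∫⁻ v : Fin m → α, ENNReal.ofReal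
        (Real.exp (l * √(‖b + ∑ j, (X (v j) - ∫ a, X a ∂ν)‖ ^ 2 + k * D ^ 2)))
          ∂(Measure.pi fun _ => ν) ≤
      ENNReal.ofReal (Real.exp (l * √(‖b‖ ^ 2 + (k + m) * D ^ 2) + m * (l ^ 2 * D ^ 2 / 2))) := by
  induction m generalizing b with
  | zero => simp
  | succ m ih =>
    rw [lintegral_pi_fin_succ ν (by fun_prop)]
    simp only [Fin.sum_univ_succ, Fin.cons_zero, Fin.cons_succ, ← add_assoc]
    refine (lintegral_mono fun a => ih (b + (X a - ∫ a, X a ∂ν))).trans ?_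
    simp only [Real.exp_add, ENNReal.ofReal_mul (Real.exp_pos _).le]
    rw [lintegral_mul_const _ (by fun_prop)]
    have h := lintegral_exp_sqrt_norm_add_sq_le ν hX hD0 hD b (k + m) hl
    push_cast at h ⊢
    refine (mul_le_mul_left h _).trans_eq ?_
    rw [← ENNReal.ofReal_mul (Real.exp_pos _).le, ← ENNReal.ofReal_mul (Real.exp_pos _).le,
      ← Real.exp_add, ← Real.exp_add]
    ring_nf

/-- Dimension-free Hoeffding inequality for the empirical mean of bounded i.i.d. vectors. -/
theorem measure_pi_norm_mean_sub_integral_gt_le (hX : Measurable X) (hD : ∀ a, ‖X a‖ ≤ D)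
    {m : ℕ} (hm : 1 ≤ m) {s : ℝ} (hs : 0 < s) (hs1 : s ≤ 1) :
    (Measure.pi fun _ : Fin m => ν)
        {v | 2 * D / √m * √(Real.log (2 / s)) <
          ‖(1 / (m : ℝ)) • ∑ j, X (v j) - ∫ a, X a ∂ν‖} ≤ ENNReal.ofReal s := by
  have hm0 : (0 : ℝ) < m := by exact_mod_cast hm
  have hmean : ∀ v : Fin m → α, (m : ℝ) * ‖(1 / (m : ℝ)) • ∑ j, X (v j) - ∫ a, X a ∂ν‖ =
      ‖∑ j, (X (v j) - ∫ a, X a ∂ν)‖ := by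
    intro v
    rw [← Real.norm_of_nonneg hm0.le, ← norm_smul, Real.norm_of_nonneg hm0.le, smul_sub, smul_smul,
      mul_one_div_cancel hm0.ne', one_smul, Finset.sum_sub_distrib]
    simp [Nat.cast_smul_eq_nsmul]
  have hne : Nonempty α := nonempty_of_isProbabilityMeasure ν
  obtain ⟨a₀⟩ := hne
  rcases ((norm_nonneg _).trans (hD a₀)).eq_or_lt with h0 | hD0
  · have hX0 : ∀ a, X a = 0 := fun a => norm_le_zero_iff.1 ((hD a).trans_eq h0.symm)
    simp [hX0, ← h0]
  set q := √(Real.log (2 / s)) with hq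
  have hlog : Real.log (2 / s) = Real.log 2 - Real.log s := Real.log_div two_ne_zero hs.ne'
  have hl2 : 0.69 < Real.log 2 := by linarith [Real.log_two_gt_d9]
  have hls : Real.log s ≤ 0 := Real.log_nonpos hs.le hs1
  have hq2 : q ^ 2 = Real.log 2 - Real.log s := by
    rw [hq, Real.sq_sqrt (by rw [hlog]; linarith), hlog]
  have hqh : 1 / 2 ≤ q := Real.le_sqrt_of_sq_le (by rw [hlog]; linarith)
  have hrm : 0 < √(m : ℝ) := Real.sqrt_pos.2 hm0
  have hrm2 : √(m : ℝ) ^ 2 = m := Real.sq_sqrt hm0.le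
  -- This `l` minimizes the Chernoff exponent, with minimum `-(2q - 1)² / 2`. That is at most `log s
  -- = log 2 - q²` because `(q - 1)² ≥ 0 > 1/2 - log 2`.
  set l := (2 * q - 1) / (√m * D) with hl
  have hl0 : 0 ≤ l := div_nonneg (by linarith) (by positivity)
  have hlD : l * (√m * D) = 2 * q - 1 := by rw [hl]; field_simp
  have hmg := lintegral_pi_exp_sqrt_norm_add_sq_le ν hX hD0 hD hl0 m 0 0
  simp only [Nat.cast_zero, zero_mul, add_zero, zero_add, Real.sqrt_sq (norm_nonneg _), norm_zero,
    ne_eq, OfNat.ofNat_ne_zero, not_false_eq_true, zero_pow] at hmg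
  have hmarkov := mul_meas_ge_le_lintegral (μ := Measure.pi fun _ : Fin m => ν)
    (f := fun v => ENNReal.ofReal (Real.exp (l * ‖∑ j, (X (v j) - ∫ a, X a ∂ν)‖)))
    (by fun_prop) (ENNReal.ofReal (Real.exp (l * (2 * D * √m * q))))
  have hexp0 : ENNReal.ofReal (Real.exp (l * (2 * D * √m * q))) ≠ 0 := by
    simp [Real.exp_pos]
  have hsub : {v : Fin m → α | 2 * D / √m * q <
      ‖(1 / (m : ℝ)) • ∑ j, X (v j) - ∫ a, X a ∂ν‖} ⊆
      {v | ENNReal.ofReal (Real.exp (l * (2 * D * √m * q))) ≤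
        ENNReal.ofReal (Real.exp (l * ‖∑ j, (X (v j) - ∫ a, X a ∂ν)‖))} := by
    intro v hv
    simp only [Set.mem_ofPred_eq] at hv ⊢
    gcongr
    rw [← hmean]
    have := mul_le_mul_of_nonneg_left hv.le hm0.le
    refine le_trans (le_of_eq ?_) this
    nth_rewrite 2 [← hrm2]
    field_simp
  refine (measure_mono hsub).trans ?_
  have h1 := hmarkov.trans hmg
  rw [mul_comm, ← ENNReal.le_div_iff_mul_le (Or.inl hexp0) (Or.inl ENNReal.ofReal_ne_top),
    ← ENNReal.ofReal_div_of_pos (Real.exp_pos _), ← Real.exp_sub] at h1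
  refine h1.trans (ENNReal.ofReal_le_ofReal ?_)
  rw [← Real.le_log_iff_exp_le hs, Real.sqrt_mul hm0.le, Real.sqrt_sq hD0.le, hlD]
  have e1 : (m : ℝ) * (l ^ 2 * D ^ 2 / 2) = (2 * q - 1) ^ 2 / 2 := by
    rw [← hlD]; linear_combination (-(l ^ 2 * D ^ 2 / 2)) * hrm2
  have e2 : l * (2 * D * √m * q) = (2 * q - 1) * (2 * q) := by
    rw [← hlD]; ring
  rw [e1, e2]
  nlinarith [sq_nonneg (q - 1)]

end Concentration

/-! ### Deviations of the empirical leaders from the expected leaders. -/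

section FreshSamples

open scoped ENNReal

attribute [local instance] isProbabilityMeasure_uniformBall

theorem ofReal_one_sub_le_measure {Ω : Type*} {mΩ : MeasurableSpace Ω} (μ : Measure Ω)
    [IsProbabilityMeasure μ] {bad good : Set Ω} {s : ℝ} (hs : 0 ≤ s)
    (hbad : μ bad ≤ ENNReal.ofReal s) (h : badᶜ ⊆ good) : ENNReal.ofReal (1 - s) ≤ μ good := by
  rw [ENNReal.ofReal_sub _ hs, ENNReal.ofReal_one, tsub_le_iff_left]
  calc 1 = μ (bad ∪ badᶜ) := by rw [Set.union_compl_self, measure_univ]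
    _ ≤ μ bad + μ badᶜ := measure_union_le _ _
    _ ≤ ENNReal.ofReal s + μ good := add_le_add hbad (measure_mono h)

variable {d m : ℕ} {K : Set (EuclideanSpace ℝ (Fin d))}
  {O : EuclideanSpace ℝ (Fin d) → EuclideanSpace ℝ (Fin d)} {D δ : ℝ}

theorem IsLinearOracle.measurable_sampledLeader (hO : IsLinearOracle K O) {β : Type*}
    [MeasurableSpace β] {V : β → Fin m → EuclideanSpace ℝ (Fin d)}
    {Y : β → EuclideanSpace ℝ (Fin d)} (hV : Measurable V) (hY : Measurable Y) :
    Measurable fun b => sampledLeader O δ (V b) (Y b) := by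
  have h : Measurable fun b => ∑ j, O (-Y b + (1 / δ) • V b j) := by
    refine Finset.measurable_sum _ fun j _ => hO.measurable.comp ?_
    exact hY.neg.add (Measurable.const_smul (measurable_pi_iff.1 hV j) (1 / δ))
  exact h.const_smul (1 / (m : ℝ))

theorem IsLinearOracle.measurable_expectedLeader (hO : IsLinearOracle K O) (δ : ℝ) :
    Measurable (expectedLeader O δ) := by
  have h : Measurable fun p : EuclideanSpace ℝ (Fin d) × EuclideanSpace ℝ (Fin d) =>
      O (-p.1 + (1 / δ) • p.2) := hO.measurable.comp (by fun_prop)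
  exact h.stronglyMeasurable.integral_prod_right.measurable

theorem integral_sampledLeader (hK : IsActionSet K D) (hO : IsLinearOracle K O) (hm : 1 ≤ m)
    (y : EuclideanSpace ℝ (Fin d)) :
    ∫ w : Fin m → EuclideanSpace ℝ (Fin d), sampledLeader O δ w y
      ∂(Measure.pi fun _ => uniformBall d) = expectedLeader O δ y := by
  have hm0 : (m : ℝ) ≠ 0 := by positivity
  have hi := hO.integrable_perturbed hK δ y
  have he : ∀ j : Fin m, Integrable (fun w : Fin m → EuclideanSpace ℝ (Fin d) =>
      O (-y + (1 / δ) • w j)) (Measure.pi fun _ => uniformBall d) := fun j =>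
    (measurePreserving_eval (fun _ : Fin m => uniformBall d) j).integrable_comp_of_integrable hi
  simp only [sampledLeader]
  rw [integral_smul, integral_finsetSum _ fun j _ => he j]
  have e : ∀ j : Fin m, ∫ w : Fin m → EuclideanSpace ℝ (Fin d), O (-y + (1 / δ) • w j)
      ∂(Measure.pi fun _ => uniformBall d) = expectedLeader O δ y := fun j =>
    integral_comp_eval (μ := fun _ : Fin m => uniformBall d) (i := j) hi.aestronglyMeasurable
  simp only [e, Finset.sum_const, Finset.card_univ, Fintype.card_fin]
  rw [← Nat.cast_smul_eq_nsmul ℝ, smul_smul, one_div_mul_cancel hm0, one_smul]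

theorem lintegral_exp_inner_sampledLeader_le (hK : IsActionSet K D) (hO : IsLinearOracle K O)
    (hm : 1 ≤ m) (y : EuclideanSpace ℝ (Fin d)) {h : EuclideanSpace ℝ (Fin d)} {H : ℝ}
    (hH : ‖h‖ ≤ H) (l : ℝ) :
    ∫⁻ w : Fin m → EuclideanSpace ℝ (Fin d), ENNReal.ofReal
        (Real.exp (l * inner ℝ h (sampledLeader O δ w y - expectedLeader O δ y)))
        ∂(Measure.pi fun _ => uniformBall d) ≤
      ENNReal.ofReal (Real.exp (l ^ 2 * (H * D) ^ 2 / 2)) := by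
  have hmeas : Measurable fun w : Fin m → EuclideanSpace ℝ (Fin d) => sampledLeader O δ w y :=
    hO.measurable_sampledLeader measurable_id measurable_const
  have hb : ∀ w : Fin m → EuclideanSpace ℝ (Fin d), ‖sampledLeader O δ w y‖ ≤ D := fun w =>
    hK.norm_le _ (sampledLeader_mem hK hO hm w y)
  have hi : Integrable (fun w : Fin m → EuclideanSpace ℝ (Fin d) => sampledLeader O δ w y)
      (Measure.pi fun _ => uniformBall d) :=
    Integrable.of_bound hmeas.aestronglyMeasurable D (ae_of_all _ hb)
  refine (lintegral_exp_mul_le_of_abs_sub_le (Measure.pi fun _ : Fin m => uniformBall d)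
    (W := fun w => inner ℝ h (sampledLeader O δ w y - expectedLeader O δ y))
    (measurable_const.inner (hmeas.sub_const _))
    -- With this centre only `⟪h, sampledLeader⟫` has to be bounded, so the half-width is `H D`
    -- instead of `2 H D`.
    (c := - inner ℝ h (expectedLeader O δ y)) (R := H * D) (fun w => ?_) l).trans_eq ?_
  · rw [inner_sub_right, sub_neg_eq_add, sub_add_cancel]
    refine (abs_real_inner_le_norm _ _).trans ?_
    gcongr
    · exact (norm_nonneg _).trans hH
    · exact hb w
  · have e : ∫ w : Fin m → EuclideanSpace ℝ (Fin d),
        inner ℝ h (sampledLeader O δ w y - expectedLeader O δ y)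
          ∂(Measure.pi fun _ => uniformBall d) = 0 := by
      have hsub := integral_inner (𝕜 := ℝ) (hi.sub (integrable_const (expectedLeader O δ y))) h
      simp only [Pi.sub_apply] at hsub
      rw [hsub, integral_sub hi (integrable_const _), integral_sampledLeader hK hO hm]
      simp
    rw [e, mul_zero, zero_add]

variable {Ω : Type*} {past future : MeasurableSpace Ω} {mΩ : MeasurableSpace Ω} {μ : Measure Ω}
  {𝓕 : ℕ → MeasurableSpace Ω} {v : ℕ → Fin m → Ω → EuclideanSpace ℝ (Fin d)}
  {Y h g : ℕ → Ω → EuclideanSpace ℝ (Fin d)} {N : ℕ} {H B : ℝ}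

theorem measurable_sum_inner_sampledLeader_sub (hO : IsLinearOracle K O) (hmono : Monotone 𝓕)
    (hv : ∀ i < N, IsFreshSample (𝓕 i) (𝓕 (i + 1)) μ (v i))
    (hY : ∀ i < N, Measurable[𝓕 i] (Y i)) (hh : ∀ i < N, Measurable[𝓕 i] (h i)) :
    Measurable[𝓕 N] fun ω => ∑ i ∈ Finset.range N, inner ℝ (h i ω)
      (sampledLeader O δ (fun j => v i j ω) (Y i ω) - expectedLeader O δ (Y i ω)) := by
  refine @Finset.measurable_sum _ _ _ _ _ _ (𝓕 N) _ _ fun i hi => ?_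
  have hi := Finset.mem_range.1 hi
  have h1 : Measurable[𝓕 N] (Y i) := (hY i hi).mono (hmono hi.le) le_rfl
  have h2 : Measurable[𝓕 N] (h i) := (hh i hi).mono (hmono hi.le) le_rfl
  have h3 : Measurable[𝓕 N] fun ω j => v i j ω :=
    @measurable_pi_lambda _ _ _ (𝓕 N) _ _ fun j =>
      ((hv i hi).measurable j).mono (hmono hi) le_rfl
  let := 𝓕 N
  exact h2.inner ((hO.measurable_sampledLeader h3 h1).sub
    ((hO.measurable_expectedLeader δ).comp h1))

variable [IsProbabilityMeasure μ]

/-- Freezing: the joint law of past data and fresh samples is a product, so the samples can be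
integrated out with the past held fixed. It takes the place of conditional expectations below. -/
theorem IsFreshSample.lintegral_comp
    {v : Fin m → Ω → EuclideanSpace ℝ (Fin d)} (h : IsFreshSample past future μ v)
    (hpast : past ≤ mΩ) (hfuture : future ≤ mΩ) {β : Type*} [MeasurableSpace β] {Y : Ω → β}
    (hY : Measurable[past] Y) {F : β × (Fin m → EuclideanSpace ℝ (Fin d)) → ℝ≥0∞}
    (hF : Measurable F) :
    ∫⁻ ω, F (Y ω, fun j => v j ω) ∂μ =
      ∫⁻ ω, ∫⁻ w, F (Y ω, w) ∂(Measure.pi fun _ => uniformBall d) ∂μ := by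
  have hY' : Measurable Y := hY.mono hpast le_rfl
  have hV : Measurable fun ω j => v j ω :=
    measurable_pi_lambda _ fun j => (h.measurable j).mono hfuture le_rfl
  have hind : IndepFun Y (fun ω j => v j ω) μ := by
    rw [IndepFun_iff_Indep]
    refine Indep.symm ?_
    refine indep_of_indep_of_le_left (indep_of_indep_of_le_right h.indep hY.comap_le) ?_
    refine Measurable.comap_le ?_
    refine @measurable_pi_lambda _ _ _ (_) _ _ fun j => ?_
    exact Measurable.mono (comap_measurable (v j)) (le_iSup
      (fun j => MeasurableSpace.comap (v j) inferInstance) j) le_rfl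
  have hmap := (indepFun_iff_map_prod_eq_prod_map_map hY'.aemeasurable hV.aemeasurable).1 hind
  rw [h.law] at hmap
  have e := lintegral_map (μ := μ) hF (hY'.prodMk hV)
  rw [← e, hmap, lintegral_prod _ hF.aemeasurable,
    lintegral_map hF.lintegral_prod_right' hY']

theorem IsFreshSample.measure_norm_sampledLeader_sub_gt_le
    {v : Fin m → Ω → EuclideanSpace ℝ (Fin d)} (h : IsFreshSample past future μ v)
    (hpast : past ≤ mΩ) (hfuture : future ≤ mΩ) (hK : IsActionSet K D) (hO : IsLinearOracle K O)
    (hm : 1 ≤ m) {Y : Ω → EuclideanSpace ℝ (Fin d)} (hY : Measurable[past] Y) {s : ℝ}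
    (hs : 0 < s) (hs1 : s ≤ 1) :
    μ {ω | 2 * D / √m * √(Real.log (2 / s)) <
      ‖sampledLeader O δ (fun j => v j ω) (Y ω) - expectedLeader O δ (Y ω)‖} ≤
        ENNReal.ofReal s := by
  have hY' : Measurable Y := hY.mono hpast le_rfl
  have hV : Measurable fun ω j => v j ω :=
    measurable_pi_lambda _ fun j => (h.measurable j).mono hfuture le_rfl
  set S : Set (EuclideanSpace ℝ (Fin d) × (Fin m → EuclideanSpace ℝ (Fin d))) :=
    {p | 2 * D / √m * √(Real.log (2 / s)) <
      ‖sampledLeader O δ p.2 p.1 - expectedLeader O δ p.1‖} with hS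
  have hSm : MeasurableSet S := measurableSet_lt measurable_const
    (((hO.measurable_sampledLeader measurable_snd measurable_fst).sub
      ((hO.measurable_expectedLeader δ).comp measurable_fst)).norm)
  have hF : Measurable (S.indicator (fun _ => (1 : ℝ≥0∞))) := measurable_const.indicator hSm
  have key := h.lintegral_comp hpast hfuture hY hF
  have e1 : ∫⁻ ω, S.indicator (fun _ => (1 : ℝ≥0∞)) (Y ω, fun j => v j ω) ∂μ =
      μ ((fun ω => (Y ω, fun j => v j ω)) ⁻¹' S) := by
    rw [← lintegral_indicator_one ((hY'.prodMk hV) hSm)]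
    rfl
  have e2 : ∀ y, ∫⁻ w, S.indicator (fun _ => (1 : ℝ≥0∞)) (y, w) ∂(Measure.pi fun _ => uniformBall d) =
      (Measure.pi fun _ => uniformBall d) (Prod.mk y ⁻¹' S) := by
    intro y
    rw [← lintegral_indicator_one (measurable_prodMk_left hSm)]
    rfl
  rw [e1] at key
  refine key.trans_le ?_
  simp only [e2]
  refine (lintegral_mono fun ω => measure_pi_norm_mean_sub_integral_gt_le (uniformBall d)
    (hO.measurable_perturbed δ (Y ω)) (fun _ => hO.norm_le hK _) hm hs hs1).trans ?_
  simp

/-- With high probability, all the empirical perturbed leaders of `N` rounds are close to the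
expected perturbed leaders. -/
theorem measure_exists_norm_sampledLeader_sub_gt_le (hK : IsActionSet K D)
    (hO : IsLinearOracle K O) (hm : 1 ≤ m) (hN : 1 ≤ N) (hle : ∀ i, 𝓕 i ≤ mΩ)
    (hv : ∀ i < N, IsFreshSample (𝓕 i) (𝓕 (i + 1)) μ (v i))
    (hY : ∀ i < N, Measurable[𝓕 i] (Y i)) {s : ℝ} (hs : 0 < s) (hs1 : s ≤ 1) :
    μ {ω | ∃ i < N, 2 * D / √m * √(Real.log (2 * N / s)) <
      ‖sampledLeader O δ (fun j => v i j ω) (Y i ω) - expectedLeader O δ (Y i ω)‖} ≤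
        ENNReal.ofReal s := by
  have hN0 : (1 : ℝ) ≤ N := by exact_mod_cast hN
  have e : {ω | ∃ i < N, 2 * D / √m * √(Real.log (2 * N / s)) <
      ‖sampledLeader O δ (fun j => v i j ω) (Y i ω) - expectedLeader O δ (Y i ω)‖} =
      ⋃ i ∈ Finset.range N, {ω | 2 * D / √m * √(Real.log (2 / (s / N))) <
      ‖sampledLeader O δ (fun j => v i j ω) (Y i ω) - expectedLeader O δ (Y i ω)‖} := by
    ext ω
    simp [div_div_eq_mul_div]
  rw [e]
  refine (measure_biUnion_finset_le _ _).trans ?_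
  refine (Finset.sum_le_sum fun i hi => (hv i (Finset.mem_range.1 hi)
    ).measure_norm_sampledLeader_sub_gt_le (hle i) (hle (i + 1)) hK hO hm
      (hY i (Finset.mem_range.1 hi)) (s := s / N) (by positivity) ?_).trans_eq ?_
  · exact (div_le_self hs.le hN0).trans hs1
  · rw [Finset.sum_const, Finset.card_range, nsmul_eq_mul, ← ENNReal.ofReal_natCast,
      ← ENNReal.ofReal_mul (by positivity)]
    congr 1
    field_simp

/-- The earlier sum, `h n` and `Y n` are determined by the past of round `n`. Freezing them and
integrating out the last samples contributes one factor `exp (l² (H D)² / 2)` per round. -/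
theorem lintegral_exp_sum_inner_sampledLeader_sub_le (hK : IsActionSet K D)
    (hO : IsLinearOracle K O) (hm : 1 ≤ m) (hle : ∀ i, 𝓕 i ≤ mΩ) (hmono : Monotone 𝓕)
    (hv : ∀ i < N, IsFreshSample (𝓕 i) (𝓕 (i + 1)) μ (v i))
    (hY : ∀ i < N, Measurable[𝓕 i] (Y i)) (hh : ∀ i < N, Measurable[𝓕 i] (h i))
    (hH : ∀ i < N, ∀ ω, ‖h i ω‖ ≤ H) (l : ℝ) :
    ∫⁻ ω, ENNReal.ofReal (Real.exp (l * ∑ i ∈ Finset.range N, inner ℝ (h i ω)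
      (sampledLeader O δ (fun j => v i j ω) (Y i ω) - expectedLeader O δ (Y i ω)))) ∂μ ≤
      ENNReal.ofReal (Real.exp (N * (l ^ 2 * (H * D) ^ 2 / 2))) := by
  induction N with
  | zero => simp
  | succ n ih =>
    have ih := ih (fun i hi => hv i (by omega)) (fun i hi => hY i (by omega))
      (fun i hi => hh i (by omega)) (fun i hi => hH i (by omega))
    have hS := measurable_sum_inner_sampledLeader_sub (N := n) (δ := δ) hO hmono
      (fun i hi => hv i (by omega)) (fun i hi => hY i (by omega)) (fun i hi => hh i (by omega))
    simp only [Finset.sum_range_succ]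
    set S : Ω → ℝ := fun ω => ∑ i ∈ Finset.range n, inner ℝ (h i ω)
      (sampledLeader O δ (fun j => v i j ω) (Y i ω) - expectedLeader O δ (Y i ω)) with hSdef
    have hZ : Measurable[𝓕 n] fun ω => (S ω, h n ω, Y n ω) :=
      hS.prodMk ((hh n (by omega)).prodMk (hY n (by omega)))
    have hF : Measurable fun p : (ℝ × EuclideanSpace ℝ (Fin d) × EuclideanSpace ℝ (Fin d)) ×
        (Fin m → EuclideanSpace ℝ (Fin d)) => ENNReal.ofReal (Real.exp (l * (p.1.1 +
          inner ℝ p.1.2.1 (sampledLeader O δ p.2 p.1.2.2 - expectedLeader O δ p.1.2.2)))) := by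
      have h1 : Measurable fun p : (ℝ × EuclideanSpace ℝ (Fin d) × EuclideanSpace ℝ (Fin d)) ×
        (Fin m → EuclideanSpace ℝ (Fin d)) =>
          inner ℝ p.1.2.1 (sampledLeader O δ p.2 p.1.2.2 - expectedLeader O δ p.1.2.2) := by
        have h2 : Measurable fun p : (ℝ × EuclideanSpace ℝ (Fin d) × EuclideanSpace ℝ (Fin d)) ×
          (Fin m → EuclideanSpace ℝ (Fin d)) => p.1.2.2 := by fun_prop
        have h3 : Measurable fun p : (ℝ × EuclideanSpace ℝ (Fin d) × EuclideanSpace ℝ (Fin d)) ×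
          (Fin m → EuclideanSpace ℝ (Fin d)) => p.1.2.1 := by fun_prop
        exact h3.inner ((hO.measurable_sampledLeader measurable_snd h2).sub
          ((hO.measurable_expectedLeader δ).comp h2))
      fun_prop
    have key := (hv n (by omega)).lintegral_comp (hle n) (hle (n + 1)) hZ hF
    refine key.trans_le ?_
    simp only [mul_add, Real.exp_add, ENNReal.ofReal_mul (Real.exp_pos _).le]
    refine (lintegral_mono fun ω => ?_).trans (?_ : ∫⁻ ω, ENNReal.ofReal (Real.exp (l * S ω)) *
      ENNReal.ofReal (Real.exp (l ^ 2 * (H * D) ^ 2 / 2)) ∂μ ≤ _)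
    · have hmw : Measurable fun w : Fin m → EuclideanSpace ℝ (Fin d) => ENNReal.ofReal
          (Real.exp (l * inner ℝ (h n ω)
            (sampledLeader O δ w (Y n ω) - expectedLeader O δ (Y n ω)))) := by
        refine ENNReal.measurable_ofReal.comp (Real.measurable_exp.comp
          (Measurable.const_mul (measurable_const.inner (Measurable.sub_const ?_ _)) _))
        exact hO.measurable_sampledLeader measurable_id measurable_const
      rw [lintegral_const_mul _ hmw]
      gcongr
      exact lintegral_exp_inner_sampledLeader_le hK hO hm _ (hH n (by omega) ω) l
    · have hS' : Measurable S := hS.mono (hle n) le_rfl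
      rw [lintegral_mul_const _ (by fun_prop)]
      refine (mul_le_mul_left ih _).trans_eq ?_
      rw [← ENNReal.ofReal_mul (Real.exp_pos _).le, ← Real.exp_add]
      push_cast
      ring_nf

/-- Azuma's inequality for the deviations of the empirical perturbed leaders. -/
theorem measure_sum_inner_sampledLeader_sub_gt_le (hK : IsActionSet K D)
    (hO : IsLinearOracle K O) (hm : 1 ≤ m) (hN : 1 ≤ N) (hle : ∀ i, 𝓕 i ≤ mΩ)
    (hmono : Monotone 𝓕) (hv : ∀ i < N, IsFreshSample (𝓕 i) (𝓕 (i + 1)) μ (v i))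
    (hY : ∀ i < N, Measurable[𝓕 i] (Y i)) (hh : ∀ i < N, Measurable[𝓕 i] (h i))
    (hH : ∀ i < N, ∀ ω, ‖h i ω‖ ≤ H) {s : ℝ} (hs : 0 < s) (hs1 : s ≤ 1) :
    μ {ω | H * D * √(2 * N * Real.log (1 / s)) < ∑ i ∈ Finset.range N, inner ℝ (h i ω)
      (sampledLeader O δ (fun j => v i j ω) (Y i ω) - expectedLeader O δ (Y i ω))} ≤
        ENNReal.ofReal s := by
  have hN0 : (1 : ℝ) ≤ N := by exact_mod_cast hN
  obtain ⟨ω₀⟩ := nonempty_of_isProbabilityMeasure μ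
  have hH0 : 0 ≤ H := (norm_nonneg _).trans (hH 0 (by omega) ω₀)
  -- If `H D = 0` the optimal `l` below is undefined, but then no summand is positive.
  rcases (mul_nonneg hH0 hK.nonneg).eq_or_lt with h0 | hR
  · rw [← h0, zero_mul]
    have hle0 : ∀ ω, ∑ i ∈ Finset.range N, inner ℝ (h i ω)
        (sampledLeader O δ (fun j => v i j ω) (Y i ω) - expectedLeader O δ (Y i ω)) ≤ 0 := by
      intro ω
      refine Finset.sum_nonpos fun i hi => (real_inner_le_norm _ _).trans ?_
      calc _ ≤ H * (2 * D) := mul_le_mul (hH i (Finset.mem_range.1 hi) ω)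
            (hK.norm_sub_le (sampledLeader_mem hK hO hm _ _) (expectedLeader_mem hK hO _))
            (norm_nonneg _) hH0
        _ = 0 := by linear_combination (-2) * h0
    simp [fun ω => (hle0 ω).not_gt]
  set q := √(2 * N * Real.log (1 / s)) with hq
  have hlog : Real.log (1 / s) = - Real.log s := by rw [one_div, Real.log_inv]
  have hls : Real.log s ≤ 0 := Real.log_nonpos hs.le hs1
  have hq2 : q ^ 2 = 2 * N * (- Real.log s) := by
    rw [hq, hlog, Real.sq_sqrt (mul_nonneg (by positivity) (by linarith))]
  -- The minimizer of the Chernoff exponent, whose minimum `-q² / (2N)` equals `log s`.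
  set l := q / (N * (H * D)) with hl
  have hl0 : 0 ≤ l := by positivity
  have hmg := lintegral_exp_sum_inner_sampledLeader_sub_le (δ := δ) hK hO hm hle hmono hv hY hh hH l
  have hmeas : Measurable fun ω => ∑ i ∈ Finset.range N, inner ℝ (h i ω)
      (sampledLeader O δ (fun j => v i j ω) (Y i ω) - expectedLeader O δ (Y i ω)) :=
    (measurable_sum_inner_sampledLeader_sub hO hmono hv hY hh).mono (hle N) le_rfl
  have hmarkov := mul_meas_ge_le_lintegral (μ := μ)
    (ENNReal.measurable_ofReal.comp (Real.measurable_exp.comp (hmeas.const_mul l)))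
    (ENNReal.ofReal (Real.exp (l * (H * D * q))))
  have hexp0 : ENNReal.ofReal (Real.exp (l * (H * D * q))) ≠ 0 := by
    simp [Real.exp_pos]
  have h1 := hmarkov.trans hmg
  rw [mul_comm, ← ENNReal.le_div_iff_mul_le (Or.inl hexp0) (Or.inl ENNReal.ofReal_ne_top),
    ← ENNReal.ofReal_div_of_pos (Real.exp_pos _), ← Real.exp_sub] at h1
  refine (measure_mono fun ω hω => ?_).trans (h1.trans (ENNReal.ofReal_le_ofReal ?_))
  · simp only [Set.mem_ofPred_eq, Function.comp_apply] at hω ⊢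
    gcongr
  · rw [← Real.le_log_iff_exp_le hs]
    refine le_of_eq ?_
    have e1 : (N : ℝ) * (l ^ 2 * (H * D) ^ 2 / 2) = q ^ 2 / (2 * N) := by
      rw [hl]
      generalize H * D = R at hR ⊢
      field_simp
    have e2 : l * (H * D * q) = q ^ 2 / N := by
      rw [hl]
      generalize H * D = R at hR ⊢
      field_simp
    rw [e1, e2, hq2]
    field_simp
    ring

/-- The total deviation of the empirical perturbed leaders, against directions that depend
smoothly on the deviations. -/
theorem ofReal_le_measure_sum_inner_sampledLeader_sub_le (hK : IsActionSet K D)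
    (hO : IsLinearOracle K O) (hm : 1 ≤ m) (hN : 1 ≤ N) (hle : ∀ i, 𝓕 i ≤ mΩ)
    (hmono : Monotone 𝓕) (hv : ∀ i < N, IsFreshSample (𝓕 i) (𝓕 (i + 1)) μ (v i))
    (hY : ∀ i < N, Measurable[𝓕 i] (Y i)) (hh : ∀ i < N, Measurable[𝓕 i] (h i))
    (hH : ∀ i < N, ∀ ω, ‖h i ω‖ ≤ H) (hB : 0 ≤ B)
    (hg : ∀ i < N, ∀ ω, ‖g i ω - h i ω‖ ≤
      B * ‖sampledLeader O δ (fun j => v i j ω) (Y i ω) - expectedLeader O δ (Y i ω)‖)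
    {s : ℝ} (hs : 0 < s) (hs1 : s ≤ 1) :
    ENNReal.ofReal (1 - s) ≤ μ {ω | ∑ i ∈ Finset.range N, inner ℝ (g i ω)
      (sampledLeader O δ (fun j => v i j ω) (Y i ω) - expectedLeader O δ (Y i ω)) ≤
        H * D * √(2 * N * Real.log (4 / s)) + N * (B * (4 * D ^ 2 / m * Real.log (4 * N / s)))} := by
  have hN0 : (1 : ℝ) ≤ N := by exact_mod_cast hN
  have hm0 : (0 : ℝ) < m := by exact_mod_cast hm
  -- The failure probabilities `s/2` and `s/4` are chosen so that the logarithms become `log (4N/s)`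
  -- and `log (4/s)`; their sum stays below `s`.
  have hA := measure_exists_norm_sampledLeader_sub_gt_le (δ := δ) hK hO hm hN hle hv hY
    (s := s / 2) (by positivity) (by linarith)
  have hZ := measure_sum_inner_sampledLeader_sub_gt_le (δ := δ) hK hO hm hN hle hmono hv hY hh hH
    (s := s / 4) (by positivity) (by linarith)
  have e4 : 1 / (s / 4) = 4 / s := by field_simp
  have e2 : 2 * (N : ℝ) / (s / 2) = 4 * N / s := by field_simp; ring
  rw [e4] at hZ
  rw [e2] at hA
  refine ofReal_one_sub_le_measure μ hs.le ((measure_union_le _ _).trans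
    ((add_le_add hA hZ).trans ?_)) fun ω hω => ?_
  · rw [← ENNReal.ofReal_add (by positivity) (by positivity)]
    exact ENNReal.ofReal_le_ofReal (by linarith)
  simp only [Set.compl_union, Set.mem_inter_iff, Set.mem_compl_iff, Set.mem_ofPred_eq, not_exists,
    not_and, not_lt] at hω ⊢
  obtain ⟨h1, h2⟩ := hω
  have hlog : 0 ≤ Real.log (4 * N / s) := by
    refine Real.log_nonneg ?_
    rw [le_div_iff₀ hs]
    linarith
  have hterm : ∀ i ∈ Finset.range N, inner ℝ (g i ω)
      (sampledLeader O δ (fun j => v i j ω) (Y i ω) - expectedLeader O δ (Y i ω)) ≤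
      inner ℝ (h i ω)
      (sampledLeader O δ (fun j => v i j ω) (Y i ω) - expectedLeader O δ (Y i ω)) +
        B * (4 * D ^ 2 / m * Real.log (4 * N / s)) := by
    intro i hi
    have hi := Finset.mem_range.1 hi
    set z := sampledLeader O δ (fun j => v i j ω) (Y i ω) - expectedLeader O δ (Y i ω) with hz
    -- The martingale part is split from the correction, which is quadratic in the deviation `z`.
    have h3 : inner ℝ (g i ω) z = inner ℝ (h i ω) z + inner ℝ (g i ω - h i ω) z := by
      rw [← inner_add_left]; congr 1; abel
    rw [h3]
    gcongr
    calc inner ℝ (g i ω - h i ω) z ≤ ‖g i ω - h i ω‖ * ‖z‖ := real_inner_le_norm _ _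
      _ ≤ B * ‖z‖ * ‖z‖ := by gcongr; exact hg i hi ω
      _ = B * ‖z‖ ^ 2 := by ring
      _ ≤ B * (2 * D / √m * √(Real.log (4 * N / s))) ^ 2 := by gcongr; exact h1 i hi
      _ = _ := by rw [mul_pow, div_pow, Real.sq_sqrt hm0.le, Real.sq_sqrt hlog]; ring
  refine (Finset.sum_le_sum hterm).trans ?_
  rw [Finset.sum_add_distrib, Finset.sum_const, Finset.card_range, nsmul_eq_mul]
  gcongr

end FreshSamples

/-! ### Linearized regret and the worst case of Expected FPL. -/

section Regret

variable {d : ℕ} {K : Set (EuclideanSpace ℝ (Fin d))}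
  {O : EuclideanSpace ℝ (Fin d) → EuclideanSpace ℝ (Fin d)} {D G δ : ℝ} {T : ℕ}

theorem sum_Icc_one_eq_sum_range {M : Type*} [AddCommMonoid M] (F : ℕ → M) (T : ℕ) :
    ∑ t ∈ Finset.Icc 1 T, F t = ∑ i ∈ Finset.range T, F (i + 1) := by
  induction T with
  | zero => simp
  | succ n ih => rw [Finset.sum_Icc_succ_top (by omega), Finset.sum_range_succ, ih]

theorem regret_le_of_isLoss (hK : IsActionSet K D)
    {f : ℕ → EuclideanSpace ℝ (Fin d) → ℝ}
    {f' : ℕ → EuclideanSpace ℝ (Fin d) → EuclideanSpace ℝ (Fin d)}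
    {x : ℕ → EuclideanSpace ℝ (Fin d)} (hf : ∀ t ∈ Finset.Icc 1 T, IsLoss K G (f t) (f' t))
    (hx : ∀ t ∈ Finset.Icc 1 T, x t ∈ K) {b : ℝ}
    (hb : ∀ u ∈ K, ∑ t ∈ Finset.Icc 1 T, inner ℝ (f' t (x t)) (x t - u) ≤ b) :
    regret K T f x ≤ b := by
  have := hK.nonempty.to_subtype
  rw [regret, sub_le_comm]
  refine le_ciInf fun u => ?_
  rw [sub_le_comm, ← Finset.sum_sub_distrib]
  exact (Finset.sum_le_sum fun t ht => (hf t ht).sub_le (hx t ht) u.2).trans (hb u u.2)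

theorem gameState_snd
    (rule : ℕ → EuclideanSpace ℝ (Fin d) → EuclideanSpace ℝ (Fin d) → EuclideanSpace ℝ (Fin d))
    (f' : ℕ → EuclideanSpace ℝ (Fin d) → EuclideanSpace ℝ (Fin d))
    (x₀ : EuclideanSpace ℝ (Fin d)) (t : ℕ) :
    (gameState rule f' x₀ t).2 =
      ∑ s ∈ Finset.range t, f' (s + 1) (gameState rule f' x₀ (s + 1)).1 := by
  induction t with
  | zero => rfl
  | succ t ih => rw [Finset.sum_range_succ, ← ih]; rfl

theorem expectedFPL_succ (f' : ℕ → EuclideanSpace ℝ (Fin d) → EuclideanSpace ℝ (Fin d)) (t : ℕ) :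
    expectedFPL O δ f' (t + 1) = expectedLeader O δ
      (∑ s ∈ Finset.range t, f' (s + 1) (expectedFPL O δ f' (s + 1))) := by
  simp only [expectedFPL]
  rw [← gameState_snd]
  rfl

theorem sampledFPL_succ {m : ℕ} (v : ℕ → Fin m → EuclideanSpace ℝ (Fin d))
    (f' : ℕ → EuclideanSpace ℝ (Fin d) → EuclideanSpace ℝ (Fin d)) (t : ℕ) :
    sampledFPL O δ v f' (t + 1) = sampledLeader O δ (v (t + 1))
      (∑ s ∈ Finset.range t, f' (s + 1) (sampledFPL O δ v f' (s + 1))) := by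
  simp only [sampledFPL]
  rw [← gameState_snd]
  rfl

theorem expectedFPLRegrets_le (hK : IsActionSet K D) (hO : IsLinearOracle K O) (hδ : 0 < δ)
    {r : ℝ} (hr : r ∈ expectedFPLRegrets K O δ G T) :
    r ≤ 2 * D / δ + δ * D * G ^ 2 * d * T / 2 := by
  obtain ⟨f, f', hf, rfl⟩ := hr
  have hD := hK.nonneg
  have hx : ∀ t ∈ Finset.Icc 1 T, expectedFPL O δ f' t ∈ K := by
    intro t ht
    obtain ⟨s, rfl⟩ := Nat.exists_eq_add_of_le' (Finset.mem_Icc.1 ht).1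
    rw [expectedFPL_succ]
    exact expectedLeader_mem hK hO _
  refine regret_le_of_isLoss hK hf hx fun u hu => ?_
  rw [sum_Icc_one_eq_sum_range]
  have h := sum_inner_expectedLeader_sub_le hK hO hδ
    (fun s => f' (s + 1) (expectedFPL O δ f' (s + 1))) T hu
  simp only [← expectedFPL_succ] at h
  refine h.trans ?_
  have hg : ∑ i ∈ Finset.range T, ‖f' (i + 1) (expectedFPL O δ f' (i + 1))‖ ^ 2 ≤ T * G ^ 2 := by
    refine (Finset.sum_le_card_nsmul _ _ (G ^ 2) fun i hi => ?_).trans_eq (by simp)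
    have hi : i + 1 ∈ Finset.Icc 1 T := by simp at hi ⊢; omega
    exact pow_le_pow_left₀ (norm_nonneg _) ((hf _ hi).norm_le _ (hx _ hi)) 2
  have := mul_le_mul_of_nonneg_left hg (show 0 ≤ δ * D * d / 2 by positivity)
  linarith

theorem isLUB_expectedFPLRegret (hK : IsActionSet K D) (hO : IsLinearOracle K O) (hδ : 0 < δ)
    (hne : (expectedFPLRegrets K O δ G T).Nonempty) :
    IsLUB (expectedFPLRegrets K O δ G T) (expectedFPLRegret K O δ G T) :=
  isLUB_csSup hne ⟨_, fun _ => expectedFPLRegrets_le hK hO hδ⟩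

theorem isLoss_inner (hK : IsActionSet K D) {g : EuclideanSpace ℝ (Fin d)} (hg : ‖g‖ ≤ G) :
    IsLoss K G (fun x => inner ℝ g x) (fun _ => g) where
  convexOn := (innerSL ℝ g).toLinearMap.convexOn hK.convex
  hasGradient _ _ := (innerSL ℝ g).hasFDerivAt.hasFDerivWithinAt
  norm_le _ _ := hg

/-- The worst-case regret of Expected Follow-the-Perturbed-Leader bounds its regret against linear
losses. -/
theorem sum_inner_expectedLeader_sub_le_expectedFPLRegret (hK : IsActionSet K D)
    (hO : IsLinearOracle K O) (hδ : 0 < δ) {g : ℕ → EuclideanSpace ℝ (Fin d)}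
    (hg : ∀ i < T, ‖g i‖ ≤ G) {u : EuclideanSpace ℝ (Fin d)} (hu : u ∈ K) :
    ∑ i ∈ Finset.range T, inner ℝ (g i) (expectedLeader O δ (∑ j ∈ Finset.range i, g j) - u) ≤
      expectedFPLRegret K O δ G T := by
  -- `g i` is the gradient of round `i + 1`. Against constant gradients Expected FPL plays the
  -- expected leaders of their partial sums, and its regret is exactly the linear one.
  set f : ℕ → EuclideanSpace ℝ (Fin d) → ℝ := fun t x => inner ℝ (g (t - 1)) x with hf
  set f' : ℕ → EuclideanSpace ℝ (Fin d) → EuclideanSpace ℝ (Fin d) := fun t _ => g (t - 1) with hf'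
  have hmem : regret K T f (expectedFPL O δ f') ∈ expectedFPLRegrets K O δ G T :=
    ⟨f, f', fun t ht => isLoss_inner hK (hg _ (by simp at ht; omega)), rfl⟩
  refine le_trans ?_ ((isLUB_expectedFPLRegret hK hO hδ ⟨_, hmem⟩).1 hmem)
  -- Without a lower bound the real infimum would take its default value `0`.
  have hbdd : BddBelow (Set.range fun u : K => ∑ t ∈ Finset.Icc 1 T, f t u) := by
    refine ⟨∑ t ∈ Finset.Icc 1 T, -(‖g (t - 1)‖ * D), ?_⟩
    rintro _ ⟨u, rfl⟩
    refine Finset.sum_le_sum fun t _ => ?_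
    have h1 := (abs_le.1 (abs_real_inner_le_norm (g (t - 1)) (u : EuclideanSpace ℝ (Fin d)))).1
    have h2 := mul_le_mul_of_nonneg_left (hK.norm_le u u.2) (norm_nonneg (g (t - 1)))
    simp only [hf]
    linarith
  have hinf := ciInf_le hbdd ⟨u, hu⟩
  rw [regret]
  refine le_trans (le_of_eq ?_) (sub_le_sub_left hinf _)
  rw [← Finset.sum_sub_distrib, sum_Icc_one_eq_sum_range]
  simp only [hf, expectedFPL_succ, hf', Nat.add_sub_cancel, inner_sub_right]

theorem IsChosenFrom.measurable_comp {Ω : Type*} {past past' : MeasurableSpace Ω}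
    {f : Ω → EuclideanSpace ℝ (Fin d) → ℝ}
    {f' : Ω → EuclideanSpace ℝ (Fin d) → EuclideanSpace ℝ (Fin d)}
    (h : IsChosenFrom past f f') (hle : past ≤ past') {x : Ω → EuclideanSpace ℝ (Fin d)}
    (hx : Measurable[past'] x) : Measurable[past'] fun ω => f' ω (x ω) := by
  have hp : @Measurable Ω (Ω × EuclideanSpace ℝ (Fin d)) past' (past.prod inferInstance)
      (fun ω => (ω, x ω)) := by
    rw [measurable_iff_comap_le]
    refine (MeasurableSpace.comap_le_iff_le_map).2 (sup_le ?_ ?_)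
    · refine MeasurableSpace.comap_le_iff_le_map.1 ?_
      rw [MeasurableSpace.comap_comp]
      exact MeasurableSpace.comap_id.trans_le hle
    · refine MeasurableSpace.comap_le_iff_le_map.1 ?_
      rw [MeasurableSpace.comap_comp]
      exact hx.comap_le
  exact h.2.comp hp

end Regret

/-! ### High-probability regret of Sampled FPL. -/

section SampledFPL

variable {d m T : ℕ} {K : Set (EuclideanSpace ℝ (Fin d))}
  {O : EuclideanSpace ℝ (Fin d) → EuclideanSpace ℝ (Fin d)} {D G δ : ℝ}

theorem sampledFPL_mem (hK : IsActionSet K D) (hO : IsLinearOracle K O) (hm : 1 ≤ m)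
    (v : ℕ → Fin m → EuclideanSpace ℝ (Fin d))
    (f' : ℕ → EuclideanSpace ℝ (Fin d) → EuclideanSpace ℝ (Fin d)) (t : ℕ) :
    sampledFPL O δ v f' (t + 1) ∈ K := by
  rw [sampledFPL_succ]
  exact sampledLeader_mem hK hO hm _ _

/-- The regret of Sampled Follow-the-Perturbed-Leader exceeds that of the expected version by at
most the deviations of the empirical leaders from the expected leaders. -/
theorem regret_sampledFPL_le (hK : IsActionSet K D) (hO : IsLinearOracle K O) (hδ : 0 < δ)
    (hm : 1 ≤ m) {v : ℕ → Fin m → EuclideanSpace ℝ (Fin d)}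
    {f : ℕ → EuclideanSpace ℝ (Fin d) → ℝ}
    {f' : ℕ → EuclideanSpace ℝ (Fin d) → EuclideanSpace ℝ (Fin d)}
    (hf : ∀ t ∈ Finset.Icc 1 T, IsLoss K G (f t) (f' t))
    {g Y : ℕ → EuclideanSpace ℝ (Fin d)}
    (hg : ∀ i, g i = f' (i + 1) (sampledFPL O δ v f' (i + 1)))
    (hY : ∀ i, Y i = ∑ s ∈ Finset.range i, g s) :
    regret K T f (sampledFPL O δ v f') ≤ expectedFPLRegret K O δ G T +
      ∑ i ∈ Finset.range T, inner ℝ (g i)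
        (sampledLeader O δ (v (i + 1)) (Y i) - expectedLeader O δ (Y i)) := by
  have hx : ∀ t ∈ Finset.Icc 1 T, sampledFPL O δ v f' t ∈ K := by
    intro t ht
    obtain ⟨s, rfl⟩ := Nat.exists_eq_add_of_le' (Finset.mem_Icc.1 ht).1
    exact sampledFPL_mem hK hO hm _ _ _
  refine regret_le_of_isLoss hK hf hx fun u hu => ?_
  have hgG : ∀ i < T, ‖g i‖ ≤ G := by
    intro i hi
    have hi : i + 1 ∈ Finset.Icc 1 T := by simp; omega
    rw [hg]
    exact (hf _ hi).norm_le _ (hx _ hi)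
  have h := sum_inner_expectedLeader_sub_le_expectedFPLRegret hK hO hδ hgG hu
  refine le_trans (le_of_eq ?_) (add_le_add_left h _)
  rw [sum_Icc_one_eq_sum_range, ← Finset.sum_add_distrib]
  refine Finset.sum_congr rfl fun i _ => ?_
  rw [← inner_add_right, ← hY, ← hg, sampledFPL_succ]
  simp only [← hg, ← hY]
  congr 1
  abel

variable {Ω : Type*} {mΩ : MeasurableSpace Ω} {μ : Measure Ω} {ℱ : Filtration ℕ mΩ}
  {v : ℕ → Fin m → Ω → EuclideanSpace ℝ (Fin d)}
  {f : ℕ → Ω → EuclideanSpace ℝ (Fin d) → ℝ}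
  {f' : ℕ → Ω → EuclideanSpace ℝ (Fin d) → EuclideanSpace ℝ (Fin d)}

/-- Adaptivity is harmless because the sum of the first `i` gradients is known after round `i`,
hence independent of the next samples. -/
theorem measurable_sum_gradient_sampledFPL (hO : IsLinearOracle K O)
    (hv : ∀ t < T, IsFreshSample (ℱ t) (ℱ (t + 1)) μ (v (t + 1)))
    (hf : ∀ t < T, IsChosenFrom (ℱ t) (f (t + 1)) (f' (t + 1))) {i : ℕ} (hi : i ≤ T) :
    Measurable[ℱ i] fun ω => ∑ s ∈ Finset.range i, f' (s + 1) ω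
      (sampledFPL O δ (fun t j => v t j ω) (fun t => f' t ω) (s + 1)) := by
  induction i with
  | zero => simp only [Finset.range_zero, Finset.sum_empty]; exact measurable_const
  | succ i ih =>
    have ih := (ih (by omega)).mono (ℱ.mono (Nat.le_succ i)) le_rfl
    simp only [Finset.sum_range_succ]
    refine ih.add ((hf i (by omega)).measurable_comp (ℱ.mono (Nat.le_succ i)) ?_)
    have e : (fun ω => sampledFPL O δ (fun t j => v t j ω) (fun t => f' t ω) (i + 1)) =
        fun ω => sampledLeader O δ (fun j => v (i + 1) j ω) (∑ s ∈ Finset.range i, f' (s + 1) ω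
          (sampledFPL O δ (fun t j => v t j ω) (fun t => f' t ω) (s + 1))) :=
      funext fun ω => sampledFPL_succ _ _ _
    rw [e]
    have hV : Measurable[ℱ (i + 1)] fun ω j => v (i + 1) j ω :=
      @measurable_pi_lambda _ _ _ (ℱ (i + 1)) _ _ fun j => (hv i (by omega)).measurable j
    let := ℱ (i + 1)
    exact hO.measurable_sampledLeader hV ih

variable [IsProbabilityMeasure μ]

theorem ofReal_le_measure_regret_sampledFPL_le (hK : IsActionSet K D) (hO : IsLinearOracle K O)
    (hδ : 0 < δ) (hT : 1 ≤ T) (hm : 1 ≤ m)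
    (hv : ∀ t < T, IsFreshSample (ℱ t) (ℱ (t + 1)) μ (v (t + 1)))
    (hf : ∀ t < T, IsChosenFrom (ℱ t) (f (t + 1)) (f' (t + 1)))
    (hloss : ∀ t ∈ Finset.Icc 1 T, ∀ ω, IsLoss K G (f t ω) (f' t ω))
    {s : ℝ} (hs : 0 < s) (hs1 : s ≤ 1) :
    ENNReal.ofReal (1 - s) ≤
      μ {ω | regret K T (fun t => f t ω)
            (sampledFPL O δ (fun t j => v t j ω) (fun t => f' t ω)) ≤
          expectedFPLRegret K O δ G T + 2 * G * D * T / √m * √(Real.log (2 * T / s))} := by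
  refine ofReal_one_sub_le_measure μ hs.le (measure_exists_norm_sampledLeader_sub_gt_le (δ := δ)
    (𝓕 := ℱ) (v := fun i => v (i + 1)) hK hO hm hT ℱ.le hv
    (fun i hi => measurable_sum_gradient_sampledFPL (δ := δ) hO hv hf hi.le) hs hs1) fun ω hω => ?_
  simp only [Set.mem_compl_iff, Set.mem_ofPred_eq, not_exists, not_and, not_lt] at hω ⊢
  refine (regret_sampledFPL_le hK hO hδ hm (fun t ht => hloss t ht ω)
    (fun _ => rfl) (fun _ => rfl)).trans ?_
  gcongr
  refine (Finset.sum_le_card_nsmul _ _ (G * (2 * D / √m * √(Real.log (2 * T / s))))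
    fun i hi => ?_).trans_eq ?_
  · have hi := Finset.mem_range.1 hi
    have hi' : i + 1 ∈ Finset.Icc 1 T := by simp; omega
    have hG := (hloss _ hi' ω).norm_le _ (sampledFPL_mem (δ := δ) hK hO hm
      (fun t j => v t j ω) (fun t => f' t ω) i)
    exact (real_inner_le_norm _ _).trans
      (mul_le_mul hG (hω i hi) (norm_nonneg _) ((norm_nonneg _).trans hG))
  · rw [Finset.card_range, nsmul_eq_mul]
    ring

theorem ofReal_le_measure_regret_sampledFPL_le_of_smooth (hK : IsActionSet K D)
    (hO : IsLinearOracle K O) (hδ : 0 < δ) (hT : 1 ≤ T) (hm : 1 ≤ m)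
    (hv : ∀ t < T, IsFreshSample (ℱ t) (ℱ (t + 1)) μ (v (t + 1)))
    (hf : ∀ t < T, IsChosenFrom (ℱ t) (f (t + 1)) (f' (t + 1)))
    (hloss : ∀ t ∈ Finset.Icc 1 T, ∀ ω, IsLoss K G (f t ω) (f' t ω))
    {β : ℝ} (hβ : 0 ≤ β) (hsmooth : ∀ t ∈ Finset.Icc 1 T, ∀ ω, IsSmoothOn K β (f' t ω))
    {s : ℝ} (hs : 0 < s) (hs1 : s ≤ 1) :
    ENNReal.ofReal (1 - s) ≤
      μ {ω | regret K T (fun t => f t ω)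
            (sampledFPL O δ (fun t j => v t j ω) (fun t => f' t ω)) ≤
          expectedFPLRegret K O δ G T + 2 * G * D * √(2 * T * Real.log (4 / s))
            + 8 * β * D ^ 2 * T / m * Real.log (4 * T / s)} := by
  have hD := hK.nonneg
  have hmem : ∀ i < T, i + 1 ∈ Finset.Icc 1 T := fun i hi => by simp; omega
  set Y : ℕ → Ω → EuclideanSpace ℝ (Fin d) := fun i ω => ∑ s ∈ Finset.range i, f' (s + 1) ω
      (sampledFPL O δ (fun t j => v t j ω) (fun t => f' t ω) (s + 1)) with hYdef
  have hY : ∀ i < T, Measurable[ℱ i] (Y i) := fun i hi =>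
    measurable_sum_gradient_sampledFPL hO hv hf hi.le
  have hX : ∀ i ω, sampledFPL O δ (fun t j => v t j ω) (fun t => f' t ω) (i + 1) =
      sampledLeader O δ (fun j => v (i + 1) j ω) (Y i ω) := fun i ω => sampledFPL_succ _ _ _
  -- The direction `h` is the gradient at the expected leader, fixed before the samples of the
  -- round; the observed gradient `g` is not, and smoothness bounds the difference. The resulting
  -- bound is half of what is claimed.
  refine (ofReal_le_measure_sum_inner_sampledLeader_sub_le (δ := δ) (𝓕 := ℱ)
    (v := fun i => v (i + 1)) (Y := Y) (h := fun i ω => f' (i + 1) ω (expectedLeader O δ (Y i ω)))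
    (g := fun i ω => f' (i + 1) ω
      (sampledFPL O δ (fun t j => v t j ω) (fun t => f' t ω) (i + 1)))
    (H := G) (B := β) hK hO hm hT ℱ.le (fun _ _ h => ℱ.mono h) hv hY (fun i hi => ?_) (fun i hi ω => ?_) hβ
    (fun i hi ω => ?_) hs hs1).trans (measure_mono fun ω hω => ?_)
  · exact (hf i hi).measurable_comp le_rfl ((hO.measurable_expectedLeader δ).comp (hY i hi))
  · exact (hloss _ (hmem i hi) ω).norm_le _ (expectedLeader_mem hK hO _)
  · rw [hX]
    exact hsmooth _ (hmem i hi) ω _ (sampledLeader_mem hK hO hm _ _) _ (expectedLeader_mem hK hO _)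
  · simp only [Set.mem_ofPred_eq] at hω ⊢
    refine (regret_sampledFPL_le hK hO hδ hm (fun t ht => hloss t ht ω)
      (fun _ => rfl) (fun _ => rfl)).trans ?_
    rw [add_assoc]
    gcongr
    refine hω.trans (add_le_add ?_ ?_)
    · have hG : 0 ≤ G := (norm_nonneg _).trans
        ((hloss _ (hmem 0 (by omega)) ω).norm_le _ (sampledFPL_mem (δ := δ) hK hO hm
          (fun t j => v t j ω) (fun t => f' t ω) 0))
      gcongr
      linarith
    · have hT0 : (1 : ℝ) ≤ T := by exact_mod_cast hT
      have hlog : 0 ≤ Real.log (4 * T / s) := by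
        refine Real.log_nonneg ?_
        rw [le_div_iff₀ hs]
        linarith
      have h0 : 0 ≤ 4 * β * D ^ 2 * T / m * Real.log (4 * T / s) := by positivity
      linear_combination h0

end SampledFPL

/-! ### Sums over blocks of rounds, truncated to `1, …, T`. -/

section BlockSums

/-- The sum of the terms of the rounds `1, …, T` that lie in the block `i k, …, i k + k - 1`. -/
def blockSum {M : Type*} [AddCommMonoid M] (k T : ℕ) (a : ℕ → M) (i : ℕ) : M :=
  ∑ j ∈ Finset.range k, if i * k + j ∈ Finset.Icc 1 T then a (i * k + j) else 0

theorem sum_blockSum {M : Type*} [AddCommMonoid M] (k T : ℕ) (a : ℕ → M) (n : ℕ) :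
    ∑ i ∈ Finset.range n, blockSum k T a i =
      ∑ t ∈ Finset.range (n * k), if t ∈ Finset.Icc 1 T then a t else 0 := by
  induction n with
  | zero => simp
  | succ n ih => rw [Finset.sum_range_succ, ih, add_mul, one_mul, Finset.sum_range_add, blockSum]

theorem sum_blockSum_eq_sum_Icc {M : Type*} [AddCommMonoid M] {k T n : ℕ} (a : ℕ → M)
    (h : T < n * k) : ∑ i ∈ Finset.range n, blockSum k T a i = ∑ t ∈ Finset.Icc 1 T, a t := by
  rw [sum_blockSum, ← Finset.sum_filter]
  refine Finset.sum_congr ?_ fun _ _ => rfl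
  ext t
  simp
  omega

/-- The first `n` blocks consist of the rounds `0, …, n k - 1`, and truncation removes only round
`0`. -/
theorem sum_blockSum_eq_sum_range {M : Type*} [AddCommMonoid M] {k T n : ℕ} (a : ℕ → M)
    (hn : 1 ≤ n * k) (h : n * k ≤ T) :
    ∑ i ∈ Finset.range n, blockSum k T a i = ∑ s ∈ Finset.range (n * k - 1), a (s + 1) := by
  rw [sum_blockSum, ← sum_Icc_one_eq_sum_range, ← Finset.sum_filter]
  refine Finset.sum_congr ?_ fun _ _ => rfl
  ext t
  simp
  omega

theorem norm_blockSum_le {E : Type*} [SeminormedAddCommGroup E] {k T : ℕ} {a : ℕ → E} {i : ℕ}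
    {G : ℝ} (hG : 0 ≤ G) (h : ∀ j < k, i * k + j ∈ Finset.Icc 1 T → ‖a (i * k + j)‖ ≤ G) :
    ‖blockSum k T a i‖ ≤ k * G := by
  refine (norm_sum_le_of_le (n := fun _ => G) _ fun j hj => ?_).trans_eq (by simp)
  split_ifs with hj'
  · exact h j (Finset.mem_range.1 hj) hj'
  · simpa using hG

theorem blockSum_congr {M : Type*} [AddCommMonoid M] {k T : ℕ} {a b : ℕ → M} {i : ℕ}
    (h : ∀ j < k, i * k + j ∈ Finset.Icc 1 T → a (i * k + j) = b (i * k + j)) :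
    blockSum k T a i = blockSum k T b i := by
  refine Finset.sum_congr rfl fun j hj => ?_
  split_ifs with hj'
  · exact h j (Finset.mem_range.1 hj) hj'
  · rfl

theorem blockSum_sub {M : Type*} [AddCommGroup M] (k T : ℕ) (a b : ℕ → M) (i : ℕ) :
    blockSum k T a i - blockSum k T b i = blockSum k T (fun t => a t - b t) i := by
  simp only [blockSum]
  rw [← Finset.sum_sub_distrib]
  refine Finset.sum_congr rfl fun j _ => ?_
  split_ifs <;> simp

theorem inner_blockSum {E : Type*} [NormedAddCommGroup E] [InnerProductSpace ℝ E] (k T : ℕ)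
    (a : ℕ → E) (i : ℕ) (z : E) :
    inner ℝ (blockSum k T a i) z = blockSum k T (fun t => inner ℝ (a t) z) i := by
  simp only [blockSum]
  rw [sum_inner]
  refine Finset.sum_congr rfl fun j _ => ?_
  split_ifs <;> simp

theorem mul_add_div_eq {i j k : ℕ} (hj : j < k) : (i * k + j) / k = i := by
  rw [mul_comm, Nat.mul_add_div (by omega), Nat.div_eq_of_lt hj, add_zero]

theorem measurable_blockSum {Ω E : Type*} [MeasurableSpace Ω] [MeasurableSpace E] [AddCommMonoid E]
    [MeasurableAdd₂ E] {k T i : ℕ} {a : Ω → ℕ → E}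
    (h : ∀ j < k, i * k + j ∈ Finset.Icc 1 T → Measurable fun ω => a ω (i * k + j)) :
    Measurable fun ω => blockSum k T (a ω) i := by
  refine Finset.measurable_sum _ fun j hj => ?_
  split_ifs with hj'
  · exact h j (Finset.mem_range.1 hj) hj'
  · exact measurable_const

end BlockSums

/-! ### OSPF as Sampled FPL on blocks. -/

section OSPF

variable {d k T : ℕ} {K : Set (EuclideanSpace ℝ (Fin d))}
  {O : EuclideanSpace ℝ (Fin d) → EuclideanSpace ℝ (Fin d)} {D G δ β : ℝ}
  {x₀ : EuclideanSpace ℝ (Fin d)}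

theorem ospf_eq_block (v : ℕ → EuclideanSpace ℝ (Fin d))
    (f' : ℕ → EuclideanSpace ℝ (Fin d) → EuclideanSpace ℝ (Fin d)) (i : ℕ) {j : ℕ} (hj : j < k) :
    ospf O δ k x₀ v f' (i * k + j) = ospf O δ k x₀ v f' (i * k) := by
  induction j with
  | zero => rfl
  | succ j ih =>
    rw [← ih (by omega)]
    have hmod : (i * k + j + 1) % k ≠ 0 := by
      rw [add_assoc, Nat.mul_add_mod', Nat.mod_eq_of_lt hj]
      omega
    rw [← add_assoc]
    simp only [ospf, gameState]
    rw [if_pos hmod]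

/-- Round `i k` opens block `i`, so the gradients seen by then are those of the complete blocks `0,
…, i - 1`: on block sums, OSPF is Sampled FPL with `m = k`. -/
theorem ospf_block (hk : 1 ≤ k) (v : ℕ → EuclideanSpace ℝ (Fin d))
    (f' : ℕ → EuclideanSpace ℝ (Fin d) → EuclideanSpace ℝ (Fin d)) {i : ℕ} (hi : 1 ≤ i)
    (hiT : i * k ≤ T) :
    ospf O δ k x₀ v f' (i * k) =
      sampledLeader O δ (fun j : Fin k => v (i * k - k + (j + 1)))
        (∑ l ∈ Finset.range i, blockSum k T (fun t => f' t (ospf O δ k x₀ v f' t)) l) := by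
  have h1 : 1 ≤ i * k := Nat.mul_pos hi hk
  rw [sum_blockSum_eq_sum_range _ h1 hiT]
  simp only [ospf]
  rw [← gameState_snd]
  obtain ⟨n, hn⟩ := Nat.exists_eq_add_of_le' h1
  have hmod : (n + 1) % k = 0 := by rw [← hn]; exact Nat.mul_mod_left i k
  rw [hn, gameState]
  simp only [hmod, Nat.add_sub_cancel, ne_eq, not_true_eq_false, if_false]

theorem ospf_block_mem (hK : IsActionSet K D) (hO : IsLinearOracle K O) (hk : 1 ≤ k)
    (hx₀ : x₀ ∈ K) (v : ℕ → EuclideanSpace ℝ (Fin d))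
    (f' : ℕ → EuclideanSpace ℝ (Fin d) → EuclideanSpace ℝ (Fin d)) (i : ℕ) :
    ospf O δ k x₀ v f' (i * k) ∈ K := by
  rcases Nat.eq_zero_or_pos i with rfl | hi
  · rw [zero_mul]
    exact hx₀
  · rw [ospf_block hk v f' hi le_rfl]
    exact sampledLeader_mem hK hO hk _ _

theorem ospf_mem (hK : IsActionSet K D) (hO : IsLinearOracle K O) (hk : 1 ≤ k)
    (hx₀ : x₀ ∈ K) (v : ℕ → EuclideanSpace ℝ (Fin d))
    (f' : ℕ → EuclideanSpace ℝ (Fin d) → EuclideanSpace ℝ (Fin d)) (t : ℕ) :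
    ospf O δ k x₀ v f' t ∈ K := by
  rw [← Nat.div_add_mod' t k, ospf_eq_block v f' _ (Nat.mod_lt t hk)]
  exact ospf_block_mem hK hO hk hx₀ v f' _

/-- The regret of OSPF, up to the deviations of the empirical leaders from the expected leaders. -/
theorem regret_ospf_le (hK : IsActionSet K D) (hO : IsLinearOracle K O) (hδ : 0 < δ) (hG : 0 ≤ G)
    (hk : 1 ≤ k) (hx₀ : x₀ ∈ K) {v : ℕ → EuclideanSpace ℝ (Fin d)}
    {f : ℕ → EuclideanSpace ℝ (Fin d) → ℝ}
    {f' : ℕ → EuclideanSpace ℝ (Fin d) → EuclideanSpace ℝ (Fin d)}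
    (hf : ∀ t ∈ Finset.Icc 1 T, IsLoss K G (f t) (f' t))
    {g Y : ℕ → EuclideanSpace ℝ (Fin d)}
    (hg : ∀ i, g i = blockSum k T (fun t => f' t (ospf O δ k x₀ v f' t)) i)
    (hY : ∀ i, Y i = ∑ l ∈ Finset.range i, g l) :
    regret K T f (ospf O δ k x₀ v f') ≤
      2 * k * G * D + 2 * D / δ + δ * D * d / 2 * (((T / k : ℕ) + 1) * (k * G) ^ 2) +
      ∑ i ∈ Finset.range (T / k), inner ℝ (g (i + 1))
        (sampledLeader O δ (fun j : Fin k => v ((i + 1) * k - k + (j + 1))) (Y (i + 1))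
          - expectedLeader O δ (Y (i + 1))) := by
  have hD := hK.nonneg
  set N := T / k with hN
  have hNk : N * k ≤ T := Nat.div_mul_le_self T k
  have hTN : T < (N + 1) * k := by
    rw [add_mul, one_mul]
    exact Nat.lt_div_mul_add hk
  refine regret_le_of_isLoss hK hf (fun t _ => ospf_mem hK hO hk hx₀ v f' t) fun u hu => ?_
  set X := ospf O δ k x₀ v f' with hX
  have hblock : ∀ i, blockSum k T (fun t => inner ℝ (f' t (X t)) (X t - u)) i =
      inner ℝ (g i) (X (i * k) - u) := by
    intro i
    rw [hg, inner_blockSum]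
    refine blockSum_congr fun j hj _ => ?_
    simp only [hX]
    rw [ospf_eq_block v f' i hj]
  have hgn : ∀ i, ‖g i‖ ≤ k * G := by
    intro i
    rw [hg]
    exact norm_blockSum_le hG fun j _ hj =>
      (hf _ hj).norm_le _ (ospf_mem hK hO hk hx₀ v f' _)
  have hlead := sum_inner_expectedLeader_sub_le hK hO hδ g (N + 1) hu
  simp only [← hY] at hlead
  have hsq : ∑ i ∈ Finset.range (N + 1), ‖g i‖ ^ 2 ≤ (N + 1) * (k * G) ^ 2 := by
    refine (Finset.sum_le_card_nsmul _ _ ((k * G) ^ 2) fun i _ =>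
      pow_le_pow_left₀ (norm_nonneg _) (hgn i) 2).trans_eq ?_
    rw [Finset.card_range, nsmul_eq_mul]
    push_cast
    ring
  have hsq' := mul_le_mul_of_nonneg_left hsq (show 0 ≤ δ * D * d / 2 by positivity)
  -- Block `0` plays `x₀` rather than a sampled leader, so it is charged the diameter bound times `k
  -- G`.
  have hfirst : inner ℝ (g 0) (X (0 * k) - expectedLeader O δ (Y 0)) ≤ 2 * k * G * D := by
    refine (real_inner_le_norm _ _).trans ?_
    have h1 := mul_le_mul (hgn 0) (hK.norm_sub_le (ospf_block_mem (δ := δ) hK hO hk hx₀ v f' 0)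
      (expectedLeader_mem (δ := δ) hK hO (Y 0))) (norm_nonneg _) (by positivity)
    refine h1.trans_eq ?_
    ring
  have hstep : ∀ i ∈ Finset.range N, inner ℝ (g (i + 1)) (X ((i + 1) * k)
      - expectedLeader O δ (Y (i + 1))) = inner ℝ (g (i + 1))
        (sampledLeader O δ (fun j : Fin k => v ((i + 1) * k - k + (j + 1))) (Y (i + 1))
          - expectedLeader O δ (Y (i + 1))) := by
    intro i hi
    have hi := Finset.mem_range.1 hi
    have hik : (i + 1) * k ≤ T := (Nat.mul_le_mul_right k hi).trans hNk
    rw [hX, ospf_block hk v f' (by omega) hik, hY]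
    simp only [hg, hX]
  rw [← sum_blockSum_eq_sum_Icc _ hTN, ← Finset.sum_congr rfl hstep]
  simp only [hblock]
  have hsplit : ∑ i ∈ Finset.range (N + 1), inner ℝ (g i) (X (i * k) - u) =
      ∑ i ∈ Finset.range (N + 1), inner ℝ (g i) (expectedLeader O δ (Y i) - u) +
      (∑ i ∈ Finset.range N, inner ℝ (g (i + 1)) (X ((i + 1) * k) - expectedLeader O δ (Y (i + 1)))
        + inner ℝ (g 0) (X (0 * k) - expectedLeader O δ (Y 0))) := by
    rw [← Finset.sum_range_succ' (fun i => inner ℝ (g i) (X (i * k) - expectedLeader O δ (Y i))),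
      ← Finset.sum_add_distrib]
    refine Finset.sum_congr rfl fun i _ => ?_
    rw [← inner_add_right]
    congr 1
    abel
  rw [hsplit]
  linarith

variable {Ω : Type*} {mΩ : MeasurableSpace Ω} {μ : Measure Ω} {ℱ : Filtration ℕ mΩ}
  {v : ℕ → Ω → EuclideanSpace ℝ (Fin d)}
  {f : ℕ → Ω → EuclideanSpace ℝ (Fin d) → ℝ}
  {f' : ℕ → Ω → EuclideanSpace ℝ (Fin d) → EuclideanSpace ℝ (Fin d)}

theorem measurable_sum_blockSum_ospf (hO : IsLinearOracle K O) (hk : 1 ≤ k)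
    (hv : ∀ i, 1 ≤ i → i * k ≤ T →
      IsFreshSample (ℱ i) (ℱ (i + 1)) μ (fun j : Fin k => v (i * k - k + (j + 1))))
    (hf : ∀ t ∈ Finset.Icc 1 T, IsChosenFrom (ℱ (t / k)) (f t) (f' t)) (i : ℕ) (hi : i * k ≤ T) :
    Measurable[ℱ i] fun ω => ∑ l ∈ Finset.range i, blockSum k T
      (fun t => f' t ω (ospf O δ k x₀ (fun t => v t ω) (fun t => f' t ω) t)) l := by
  induction i with
  | zero => simp only [Finset.range_zero, Finset.sum_empty]; exact measurable_const
  | succ i ih =>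
    have hik : i * k ≤ T := (Nat.mul_le_mul_right k (Nat.le_succ i)).trans hi
    have ih := (ih hik).mono (ℱ.mono (Nat.le_succ i)) le_rfl
    have hX : Measurable[ℱ (i + 1)] fun ω =>
        ospf O δ k x₀ (fun t => v t ω) (fun t => f' t ω) (i * k) := by
      rcases Nat.eq_zero_or_pos i with rfl | hpos
      · simp only [zero_mul]
        exact measurable_const
      · have e : (fun ω => ospf O δ k x₀ (fun t => v t ω) (fun t => f' t ω) (i * k)) = fun ω =>
            sampledLeader O δ (fun j : Fin k => v (i * k - k + (j + 1)) ω)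
            (∑ l ∈ Finset.range i, blockSum k T
              (fun t => f' t ω (ospf O δ k x₀ (fun t => v t ω) (fun t => f' t ω) t)) l) :=
          funext fun ω => ospf_block hk _ _ hpos hik
        rw [e]
        have hV : Measurable[ℱ (i + 1)] fun ω (j : Fin k) => v (i * k - k + (j + 1)) ω :=
          @measurable_pi_lambda _ _ _ (ℱ (i + 1)) _ _ fun j => (hv i hpos hik).measurable j
        let := ℱ (i + 1)
        exact hO.measurable_sampledLeader hV ih
    simp only [Finset.sum_range_succ]
    refine ih.add ?_
    refine @measurable_blockSum _ _ (ℱ (i + 1)) _ _ _ _ _ _ _ fun j hj hjT => ?_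
    have hch := hf _ hjT
    rw [mul_add_div_eq hj] at hch
    simp only [ospf_eq_block _ _ i hj]
    exact hch.measurable_comp (ℱ.mono (Nat.le_succ i)) hX

variable [IsProbabilityMeasure μ]

theorem ofReal_le_measure_regret_ospf_le (hK : IsActionSet K D) (hO : IsLinearOracle K O)
    (hδ : 0 < δ) (hG : 0 ≤ G) (hβ : 0 ≤ β) (hk : 1 ≤ k) (hkT : k ≤ T) (hx₀ : x₀ ∈ K)
    (hv : ∀ i, 1 ≤ i → i * k ≤ T →
      IsFreshSample (ℱ i) (ℱ (i + 1)) μ (fun j : Fin k => v (i * k - k + (j + 1))))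
    (hf : ∀ t ∈ Finset.Icc 1 T, IsChosenFrom (ℱ (t / k)) (f t) (f' t))
    (hloss : ∀ t ∈ Finset.Icc 1 T, ∀ ω, IsLoss K G (f t ω) (f' t ω))
    (hsmooth : ∀ t ∈ Finset.Icc 1 T, ∀ ω, IsSmoothOn K β (f' t ω))
    {s : ℝ} (hs : 0 < s) (hs1 : s ≤ 1) :
    ENNReal.ofReal (1 - s) ≤
      μ {ω | regret K T (fun t => f t ω) (ospf O δ k x₀ (fun t => v t ω) (fun t => f' t ω)) ≤
        2 * k * G * D + 2 * D / δ + δ * D * d / 2 * (((T / k : ℕ) + 1) * (k * G) ^ 2) +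
        (k * G * D * √(2 * (T / k : ℕ) * Real.log (4 / s)) + (T / k : ℕ) *
          (k * β * (4 * D ^ 2 / k * Real.log (4 * (T / k : ℕ) / s))))} := by
  have hN1 : 1 ≤ T / k := Nat.div_pos hkT hk
  have hik : ∀ i < T / k, (i + 1) * k ≤ T := fun i hi =>
    (Nat.mul_le_mul_right k hi).trans (Nat.div_mul_le_self T k)
  set g : ℕ → Ω → EuclideanSpace ℝ (Fin d) := fun i ω => blockSum k T
      (fun t => f' t ω (ospf O δ k x₀ (fun t => v t ω) (fun t => f' t ω) t)) i with hgdef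
  set Y : ℕ → Ω → EuclideanSpace ℝ (Fin d) := fun i ω => ∑ l ∈ Finset.range i, g l ω with hYdef
  have hY : ∀ i < T / k, Measurable[ℱ (i + 1)] (Y (i + 1)) := fun i hi =>
    measurable_sum_blockSum_ospf hO hk hv hf (i + 1) (hik i hi)
  -- All indices are shifted by one because block `0` draws no samples.
  refine (ofReal_le_measure_sum_inner_sampledLeader_sub_le (δ := δ) (𝓕 := fun i => ℱ (i + 1))
    (v := fun i (j : Fin k) => v ((i + 1) * k - k + (j + 1))) (Y := fun i => Y (i + 1))
    (h := fun i ω => blockSum k T (fun t => f' t ω (expectedLeader O δ (Y (i + 1) ω))) (i + 1))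
    (g := fun i => g (i + 1)) (H := k * G) (B := k * β) hK hO hk hN1 (fun i => ℱ.le _)
    (fun i j h => ℱ.mono (Nat.succ_le_succ h)) (fun i hi => hv (i + 1) (by omega) (hik i hi)) hY
    (fun i hi => ?_) (fun i hi ω => ?_) (by positivity)
    (fun i hi ω => ?_) hs hs1).trans (measure_mono fun ω hω => ?_)
  · refine @measurable_blockSum _ _ (ℱ (i + 1)) _ _ _ _ _ _ _ fun j hj hjT => ?_
    have hch := hf _ hjT
    rw [mul_add_div_eq hj] at hch
    exact hch.measurable_comp le_rfl ((hO.measurable_expectedLeader δ).comp (hY i hi))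
  · exact norm_blockSum_le hG fun j _ hjT =>
      (hloss _ hjT ω).norm_le _ (expectedLeader_mem hK hO _)
  · simp only [hgdef]
    rw [blockSum_sub, mul_assoc]
    refine norm_blockSum_le (by positivity) fun j hj hjT => ?_
    rw [ospf_eq_block _ _ _ hj, ospf_block hk _ _ (by omega) (hik i hi)]
    exact hsmooth _ hjT ω _ (sampledLeader_mem hK hO hk _ _) _ (expectedLeader_mem hK hO _)
  · simp only [Set.mem_ofPred_eq] at hω ⊢
    refine (regret_ospf_le hK hO hδ hG hk hx₀ (fun t ht => hloss t ht ω)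
      (fun _ => rfl) (fun _ => rfl)).trans ?_
    gcongr

/-- The choice of the parameters of OSPF. -/
theorem ospf_bound_le (hd : 1 ≤ d) (hD : 0 ≤ D) (hG : 0 < G) (hβ : 0 ≤ β) (hT : 1 ≤ T)
    (hk : k = ⌈(T : ℝ) ^ (1 / 3 : ℝ)⌉₊) (hδ : δ = 2 / (G * √d * (T : ℝ) ^ (2 / 3 : ℝ)))
    {s : ℝ} (hs : 0 < s) (hs1 : s ≤ 1) (hN1 : 1 ≤ T / k) :
    2 * k * G * D + 2 * D / δ + δ * D * d / 2 * (((T / k : ℕ) + 1) * (k * G) ^ 2) +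
        (k * G * D * √(2 * (T / k : ℕ) * Real.log (4 / s)) + (T / k : ℕ) *
          (k * β * (4 * D ^ 2 / k * Real.log (4 * (T / k : ℕ) / s)))) ≤
      13 * (D * (G * √d + β * D)) * (T : ℝ) ^ (2 / 3 : ℝ) * Real.log (4 * T / s) := by
  have hT0 : (1 : ℝ) ≤ T := by exact_mod_cast hT
  set τ := (T : ℝ) ^ (1 / 3 : ℝ) with hτ
  have hτ1 : 1 ≤ τ := Real.one_le_rpow hT0 (by norm_num)
  have hτ2 : (T : ℝ) ^ (2 / 3 : ℝ) = τ ^ 2 := by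
    rw [hτ, ← Real.rpow_natCast, ← Real.rpow_mul (by linarith)]
    norm_num
  have hτ3 : (T : ℝ) = τ ^ 3 := by
    rw [hτ, ← Real.rpow_natCast, ← Real.rpow_mul (by linarith)]
    norm_num
  have hk1 : τ ≤ k := by rw [hk]; exact Nat.le_ceil _
  have hk2 : (k : ℝ) ≤ 2 * τ := by
    have := Nat.ceil_lt_add_one (show 0 ≤ τ by linarith)
    rw [← hk] at this
    linarith
  have hkpos : (0 : ℝ) < k := by linarith
  have hNk : ((T / k : ℕ) : ℝ) * k ≤ τ ^ 3 := by
    rw [← hτ3]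
    exact_mod_cast Nat.div_mul_le_self T k
  have hNT : ((T / k : ℕ) : ℝ) ≤ T := by exact_mod_cast Nat.div_le_self T k
  have hN0 : (1 : ℝ) ≤ (T / k : ℕ) := by exact_mod_cast hN1
  rw [hτ2] at hδ ⊢
  set N : ℝ := ((T / k : ℕ) : ℝ) with hN
  have hNτ : N ≤ τ ^ 2 := by
    have h1 : N * τ ≤ τ ^ 2 * τ := (mul_le_mul_of_nonneg_left hk1 (by linarith)).trans
      (hNk.trans_eq (by ring))
    exact le_of_mul_le_mul_right h1 (by linarith)
  set L := Real.log (4 * T / s) with hL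
  have hlog4 : 1 ≤ Real.log 4 := by
    rw [show (4 : ℝ) = 2 ^ 2 by norm_num, Real.log_pow]
    push_cast
    linarith [Real.log_two_gt_d9]
  have hl4 : Real.log (4 / s) ≤ L := Real.log_le_log (by positivity) (by gcongr; linarith)
  have hl40 : 1 ≤ Real.log (4 / s) := hlog4.trans
    (Real.log_le_log (by norm_num) (by rw [le_div_iff₀ hs]; linarith))
  have hL1 : 1 ≤ L := hl40.trans hl4
  have hlN : Real.log (4 * N / s) ≤ L := Real.log_le_log (by positivity) (by gcongr)
  have hlN0 : 0 ≤ Real.log (4 * N / s) := Real.log_nonneg (by rw [le_div_iff₀ hs]; linarith)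
  set r := √(d : ℝ) with hr
  have hr1 : 1 ≤ r := Real.one_le_sqrt.2 (by exact_mod_cast hd)
  have hr2 : (d : ℝ) = r ^ 2 := (Real.sq_sqrt (by positivity)).symm
  have hτL : τ ^ 2 ≤ τ ^ 2 * L := le_mul_of_one_le_right (by positivity) hL1
  have hGr : G ≤ G * r := le_mul_of_one_le_right hG.le hr1
  have b1 : 2 * k * G * D ≤ 4 * (D * (G * r) * (τ ^ 2 * L)) := by
    have h1 : (k : ℝ) ≤ 2 * (τ ^ 2 * L) := by nlinarith
    calc 2 * k * G * D = 2 * (D * G * k) := by ring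
      _ ≤ 2 * (D * (G * r) * (2 * (τ ^ 2 * L))) := by gcongr
      _ = _ := by ring
  have b2 : 2 * D / δ ≤ D * (G * r) * (τ ^ 2 * L) := by
    calc 2 * D / δ = D * (G * r) * τ ^ 2 := by rw [hδ]; field_simp
      _ ≤ _ := by gcongr
  have b3 : δ * D * d / 2 * ((N + 1) * (k * G) ^ 2) ≤ 6 * (D * (G * r) * (τ ^ 2 * L)) := by
    have h1 : (N + 1) * k ^ 2 ≤ 6 * τ ^ 4 := by
      calc (N + 1) * (k : ℝ) ^ 2 = (N * k + k) * k := by ring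
        _ ≤ (τ ^ 3 + 2 * τ) * (2 * τ) := by gcongr
        _ ≤ (τ ^ 3 + 2 * τ ^ 3) * (2 * τ) := by
          gcongr
          exact le_self_pow₀ hτ1 (by norm_num)
        _ = 6 * τ ^ 4 := by ring
    calc δ * D * d / 2 * ((N + 1) * (k * G) ^ 2)
        = D * (G * r) / τ ^ 2 * ((N + 1) * k ^ 2) := by rw [hδ, hr2]; field_simp
      _ ≤ D * (G * r) / τ ^ 2 * (6 * τ ^ 4) := by gcongr
      _ = 6 * (D * (G * r) * τ ^ 2) := by field_simp
      _ ≤ _ := by gcongr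
  have b4 : k * G * D * √(2 * N * Real.log (4 / s)) ≤ 2 * (D * (G * r) * (τ ^ 2 * L)) := by
    have h1 : k * √(2 * N * Real.log (4 / s)) ≤ 2 * (τ ^ 2 * L) := by
      rw [← Real.sqrt_sq hkpos.le, ← Real.sqrt_mul (by positivity), Real.sqrt_le_iff]
      refine ⟨by positivity, ?_⟩
      calc (k : ℝ) ^ 2 * (2 * N * Real.log (4 / s))
          = 2 * (N * k) * k * Real.log (4 / s) := by ring
        _ ≤ 2 * τ ^ 3 * (2 * τ) * L := by gcongr
        _ ≤ 2 * τ ^ 3 * (2 * τ) * L * L := le_mul_of_one_le_right (by positivity) hL1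
        _ = (2 * (τ ^ 2 * L)) ^ 2 := by ring
    calc k * G * D * √(2 * N * Real.log (4 / s))
        = D * G * (k * √(2 * N * Real.log (4 / s))) := by ring
      _ ≤ D * (G * r) * (2 * (τ ^ 2 * L)) := by gcongr
      _ = _ := by ring
  have b5 : N * (k * β * (4 * D ^ 2 / k * Real.log (4 * N / s))) ≤
      13 * (D * (β * D) * (τ ^ 2 * L)) := by
    calc N * (k * β * (4 * D ^ 2 / k * Real.log (4 * N / s)))
        = 4 * β * D ^ 2 * (N * Real.log (4 * N / s)) := by field_simp
      _ ≤ 4 * β * D ^ 2 * (τ ^ 2 * L) := by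
          gcongr
      _ ≤ 13 * β * D ^ 2 * (τ ^ 2 * L) := by gcongr; norm_num
      _ = _ := by ring
  -- The terms in `G √d` have coefficients `4 + 1 + 6 + 2 = 13`, and the smoothness coefficient `4`
  -- was rounded up to match.
  linarith

end OSPF

/-- High-probability regret bounds. First part: Sampled FPL against an adaptive adversary, where
`ℱ t` is the information available after round `t`. Second part: OSPF against an adversary that
is adaptive between blocks, where `ℱ i` is the information available before the samples of the
block of rounds `i k, …, i k + k - 1` are drawn. -/
theorem mainTheorem3 :
    (∀ (d : ℕ) (K : Set (EuclideanSpace ℝ (Fin d)))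
      (O : EuclideanSpace ℝ (Fin d) → EuclideanSpace ℝ (Fin d)) (D G δ : ℝ) (T m : ℕ),
      IsActionSet K D → IsLinearOracle K O → 0 < δ → 1 ≤ T → 1 ≤ m →
      ∀ {Ω : Type*} {mΩ : MeasurableSpace Ω} (μ : Measure Ω) [IsProbabilityMeasure μ]
        (ℱ : Filtration ℕ mΩ)
        (v : ℕ → Fin m → Ω → EuclideanSpace ℝ (Fin d))
        (f : ℕ → Ω → EuclideanSpace ℝ (Fin d) → ℝ)
        (f' : ℕ → Ω → EuclideanSpace ℝ (Fin d) → EuclideanSpace ℝ (Fin d)),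
      (∀ t < T, IsFreshSample (ℱ t) (ℱ (t + 1)) μ (v (t + 1))) →
      (∀ t < T, IsChosenFrom (ℱ t) (f (t + 1)) (f' (t + 1))) →
      (∀ t ∈ Finset.Icc 1 T, ∀ ω, IsLoss K G (f t ω) (f' t ω)) →
      IsLUB (expectedFPLRegrets K O δ G T) (expectedFPLRegret K O δ G T) ∧
      expectedFPLRegret K O δ G T ≤ 2 * D / δ + δ * D * G ^ 2 * d * T / 2 ∧
      (∀ σ : ℝ, 0 < σ →
        ENNReal.ofReal (1 - σ) ≤
          μ {ω | regret K T (fun t => f t ω)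
                (sampledFPL O δ (fun t j => v t j ω) (fun t => f' t ω)) ≤
              expectedFPLRegret K O δ G T
                + 2 * G * D * T / √m * √(Real.log (2 * T / σ))}) ∧
      (∀ β : ℝ, 0 ≤ β → (∀ t ∈ Finset.Icc 1 T, ∀ ω, IsSmoothOn K β (f' t ω)) →
        ∀ σ : ℝ, 0 < σ →
        ENNReal.ofReal (1 - σ) ≤
          μ {ω | regret K T (fun t => f t ω)
                (sampledFPL O δ (fun t j => v t j ω) (fun t => f' t ω)) ≤
              expectedFPLRegret K O δ G T
                + 2 * G * D * √(2 * T * Real.log (4 / σ))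
                + 8 * β * D ^ 2 * T / m * Real.log (4 * T / σ)})) ∧
    (∃ C : ℝ, 0 < C ∧
      ∀ (d : ℕ) (K : Set (EuclideanSpace ℝ (Fin d)))
        (O : EuclideanSpace ℝ (Fin d) → EuclideanSpace ℝ (Fin d)) (D G β δ : ℝ) (T k : ℕ)
        (x₀ : EuclideanSpace ℝ (Fin d)),
      IsActionSet K D → IsLinearOracle K O → x₀ ∈ K → 0 < G → 0 ≤ β → 1 ≤ T →
      k = ⌈(T : ℝ) ^ (1 / 3 : ℝ)⌉₊ → δ = 2 / (G * √d * (T : ℝ) ^ (2 / 3 : ℝ)) →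
      ∀ {Ω : Type*} {mΩ : MeasurableSpace Ω} (μ : Measure Ω) [IsProbabilityMeasure μ]
        (ℱ : Filtration ℕ mΩ)
        (v : ℕ → Ω → EuclideanSpace ℝ (Fin d))
        (f : ℕ → Ω → EuclideanSpace ℝ (Fin d) → ℝ)
        (f' : ℕ → Ω → EuclideanSpace ℝ (Fin d) → EuclideanSpace ℝ (Fin d)),
      (∀ i, 1 ≤ i → i * k ≤ T →
        IsFreshSample (ℱ i) (ℱ (i + 1)) μ (fun j : Fin k => v (i * k - k + (j + 1)))) →
      (∀ t ∈ Finset.Icc 1 T, IsChosenFrom (ℱ (t / k)) (f t) (f' t)) →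
      (∀ t ∈ Finset.Icc 1 T, ∀ ω, IsLoss K G (f t ω) (f' t ω)) →
      (∀ t ∈ Finset.Icc 1 T, ∀ ω, IsSmoothOn K β (f' t ω)) →
      ∀ σ : ℝ, 0 < σ →
        ENNReal.ofReal (1 - σ) ≤
          μ {ω | regret K T (fun t => f t ω)
                (ospf O δ k x₀ (fun t => v t ω) (fun t => f' t ω)) ≤
              C * (D * (G * √d + β * D)) * (T : ℝ) ^ (2 / 3 : ℝ)
                * Real.log (4 * T / σ)}) := by
  refine ⟨?_, 13, by norm_num, ?_⟩
  · intro d K O D G δ T m hK hO hδ hT hm Ω mΩ μ _ ℱ v f f' hv hf hloss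
    -- Any realisation of the adversary's losses shows that the set of regrets is nonempty, as its
    -- supremum requires.
    obtain ⟨ω₀⟩ := nonempty_of_isProbabilityMeasure μ
    have hlub := isLUB_expectedFPLRegret (G := G) (T := T) hK hO hδ
      ⟨_, fun t => f t ω₀, fun t => f' t ω₀, fun t ht => hloss t ht ω₀, rfl⟩
    refine ⟨hlub, hlub.2 fun r hr => expectedFPLRegrets_le hK hO hδ hr, fun s hs => ?_,
      fun β hβ hsmooth s hs => ?_⟩
    · rcases le_or_gt s 1 with hs1 | hs1
      · exact ofReal_le_measure_regret_sampledFPL_le hK hO hδ hT hm hv hf hloss hs hs1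
      · rw [ENNReal.ofReal_of_nonpos (by linarith)]
        exact zero_le
    · rcases le_or_gt s 1 with hs1 | hs1
      · exact ofReal_le_measure_regret_sampledFPL_le_of_smooth hK hO hδ hT hm hv hf hloss hβ
          hsmooth hs hs1
      · rw [ENNReal.ofReal_of_nonpos (by linarith)]
        exact zero_le
  · intro d K O D G β δ T k x₀ hK hO hx₀ hG hβ hT hk hδ Ω mΩ μ _ ℱ v f f' hv hf hloss hsmooth s hs
    rcases le_or_gt s 1 with hs1 | hs1
    swap
    · rw [ENNReal.ofReal_of_nonpos (by linarith)]
      exact zero_le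
    have hD := hK.nonneg
    have hT0 : (1 : ℝ) ≤ T := by exact_mod_cast hT
    have hkT : k ≤ T := by
      rw [hk, Nat.ceil_le]
      exact Real.rpow_le_self_of_one_le hT0 (by norm_num)
    have hk1 : 1 ≤ k := by
      rw [hk, Nat.one_le_ceil_iff]
      positivity
    -- In dimension `0` the formula gives `δ = 2 / 0 = 0`, so the general bound does not apply; but
    -- there is only one action, and the regret is at most `0`.
    rcases Nat.eq_zero_or_pos d with rfl | hd
    · have hlog : 0 ≤ Real.log (4 * T / s) := Real.log_nonneg (by rw [le_div_iff₀ hs]; linarith)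
      have hall : ∀ ω, regret K T (fun t => f t ω)
          (ospf O δ k x₀ (fun t => v t ω) (fun t => f' t ω)) ≤
            13 * (D * (G * √((0 : ℕ) : ℝ) + β * D)) * (T : ℝ) ^ (2 / 3 : ℝ)
              * Real.log (4 * T / s) := by
        intro ω
        refine regret_le_of_isLoss hK (fun t ht => hloss t ht ω)
          (fun t _ => ospf_mem hK hO hk1 hx₀ _ _ t) fun u _ => ?_
        refine le_trans (le_of_eq (Finset.sum_eq_zero fun t _ => ?_)) (by positivity)
        rw [Subsingleton.elim (ospf O δ k x₀ (fun t => v t ω) (fun t => f' t ω) t) u, sub_self,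
          inner_zero_right]
      simp only [hall, Set.ofPred_true, measure_univ]
      exact ENNReal.ofReal_le_one.2 (by linarith)
    · have hd0 : (0 : ℝ) < d := by exact_mod_cast hd
      have hδ0 : 0 < δ := by rw [hδ]; positivity
      refine (ofReal_le_measure_regret_ospf_le hK hO hδ0 hG.le hβ hk1 hkT hx₀ hv hf hloss hsmooth
        hs hs1).trans (measure_mono fun ω hω => ?_)
      exact le_trans hω
        (ospf_bound_le hd hD hG hβ hT hk hδ hs hs1 (Nat.div_pos hkT hk1))
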